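/- Let $n \ge 3$ be an integer and let $p > 1$ be a real number. Let $\mathcal P^n_o$ be the set of all convex polytopes in $\mathbb R^n$ (convex hulls of finite sets) that contain the origin $o$, and let $C_p(\mathbb R^n)$ be the vector space of all continuous functions $f\colon \mathbb R^n \to \mathbb R$ with $f(sx) = s^p f(x)$ for all $s > 0$, $x \in \mathbb R^n$. Let $T^n = \operatorname{conv}\{o, e_1, \ldots, e_n\}$ be the standard simplex. For a convex body $K$ let $h(K,u) = \max_{x\in K}\langle x,u\rangle$ be its support function. For $P \in \mathcal P^n_o$ and a unit vector $v$ let $F(P,v) = P \cap \{x : \langle x, v\rangle = h(P,v)\}$, and let $\mathcal N(P)$ be the set of outer unit normals of facets of $P$, i.e. of all unit vectors $v$ such that $\dim F(P,v) = n-1$. The asymmetric $L_p$ projection bodies $\Pi_p^+P$ and $\Pi_p^-P$ are the convex bodies containing the origin with $$h(\Pi_p^{\pm}P,u)^p = \sum_{v \in \mathcal N(P),\ o \notin F(P,v)} \operatorname{vol}_{n-1}(F(P,v))\, h(P,v)^{1-p}\, \langle v,u\rangle_{\pm}^p , \qquad u \in \mathbb R^n,$$ where $t_+ = \max\{t,0\}$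 and $t_- = \max\{-t,0\}$. Let $\Phi\colon \mathcal P^n_o \to C_p(\mathbb R^n)$ be a map such that 1. $\Phi$ is a valuation: $\Phi(K\cup L) + \Phi(K\cap L) = \Phi(K) + \Phi(L)$ for all $K, L \in \mathcal P^n_o$ with $K\cup L, K\cap L \in \mathcal P^n_o$; 2. $\Phi$ is $\mathrm{SL}(n)$-contravariant: $\Phi(\phi P) = \Phi(P)\circ\phi^{-1}$ for all $P \in \mathcal P^n_o$ and $\phi \in \mathrm{SL}(n)$; 3. for every $y \in \mathbb R^n$ there is a nonempty bounded open interval $I_y \subseteq (0,\infty)$ such that $\{\Phi(sT^n)(y) : s \in I_y\}$ is not dense in $\mathbb R$. Then there are constants $c_1, c_2 \in \mathbb R$ such that $$\Phi P = c_1\, h(\Pi_p^+P,\cdot)^p + c_2\, h(\Pi_p^-P,\cdot)^p \qquad \text{for all } P \in \mathcal P^n_o.$$ -/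

import Mathlib

open scoped RealInnerProductSpace MeasureTheory

noncomputable section

namespace LpVal

/-- The Euclidean space `ℝⁿ`. -/
abbrev Rn (n : ℕ) : Type := EuclideanSpace ℝ (Fin n)

/-! ### Convex polytopes containing the origin -/

/-- A convex polytope: the convex hull of a finite set of points. -/
def IsConvexPolytope {n : ℕ} (P : Set (Rn n)) : Prop :=
  ∃ V : Finset (Rn n), P = convexHull ℝ (V : Set (Rn n))

/-- The set `𝒫ⁿ_o` of all convex polytopes in `ℝⁿ` that contain the origin. -/
def PolytopeO (n : ℕ) : Type :=
  {P : Set (Rn n) // IsConvexPolytope P ∧ (0 : Rn n) ∈ P}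

/-- The image `A P` of a polytope `P ∈ 𝒫ⁿ_o` under a linear map `A`. -/
def PolytopeO.map {n : ℕ} (A : Rn n →ₗ[ℝ] Rn n) (P : PolytopeO n) : PolytopeO n :=
  ⟨A '' P.1, by
    classical
    obtain ⟨⟨V, hV⟩, h0⟩ := P.2
    refine ⟨⟨V.image A, ?_⟩, ⟨0, h0, map_zero A⟩⟩
    rw [hV, LinearMap.image_convexHull, Finset.coe_image]⟩

/-- The dilate `s P = {s x : x ∈ P}`. -/
def PolytopeO.scale {n : ℕ} (s : ℝ) (P : PolytopeO n) : PolytopeO n :=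
  P.map (s • LinearMap.id)

/-- The standard simplex `Tⁿ = conv {o, e₁, …, eₙ}`. -/
def stdSimplexO (n : ℕ) : PolytopeO n :=
  ⟨convexHull ℝ (insert 0 (Set.range fun i : Fin n => EuclideanSpace.single i (1 : ℝ))), by
    classical
    refine ⟨⟨insert 0 (Finset.univ.image fun i : Fin n => EuclideanSpace.single i (1 : ℝ)), ?_⟩,
      subset_convexHull ℝ _ (Set.mem_insert _ _)⟩
    simp⟩

/-! ### Valuations, `p`-homogeneous functions and contravariance -/

/-- A valuation on `𝒫ⁿ_o`: `Φ(K ∪ L) + Φ(K ∩ L) = Φ(K) + Φ(L)` whenever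
`K`, `L`, `K ∪ L` and `K ∩ L` all belong to `𝒫ⁿ_o`. -/
def IsValuation {n : ℕ} {A : Type*} [Add A] (Φ : PolytopeO n → A) : Prop :=
  ∀ K L U I : PolytopeO n, U.1 = K.1 ∪ L.1 → I.1 = K.1 ∩ L.1 → Φ U + Φ I = Φ K + Φ L

/-- The space `C_p(ℝⁿ)` of all continuous functions `f` on `ℝⁿ` with
`f(s x) = s ^ p f(x)` for all `s > 0`. -/
def Cp (n : ℕ) (p : ℝ) : Submodule ℝ C(Rn n, ℝ) where
  carrier := {f | ∀ s : ℝ, 0 < s → ∀ x, f (s • x) = s ^ p * f x}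
  add_mem' := by
    intro f g hf hg s hs x
    simp only [ContinuousMap.add_apply, hf s hs x, hg s hs x]
    ring
  zero_mem' := by intro s _ x; simp
  smul_mem' := by
    intro c f hf s hs x
    simp only [ContinuousMap.smul_apply, smul_eq_mul, hf s hs x]
    ring

/-- `SL(n)`-contravariance: `Φ(φ P) = Φ(P) ∘ φ⁻¹` for all `φ ∈ SL(n)`. -/
def IsSLContravariant {n : ℕ} {p : ℝ} (Φ : PolytopeO n → Cp n p) : Prop :=
  ∀ (φ : Matrix.SpecialLinearGroup (Fin n) ℝ) (P : PolytopeO n) (x : Rn n),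
    (Φ (P.map (Matrix.toEuclideanLin φ.1))).1 x = (Φ P).1 (Matrix.toEuclideanLin (φ⁻¹).1 x)

/-! ### Support functions, faces and facets -/

/-- The support function `h(K, u) = max {⟨x, u⟩ : x ∈ K}`. -/
def supportFn {n : ℕ} (K : Set (Rn n)) (u : Rn n) : ℝ :=
  sSup ((fun x : Rn n => ⟪x, u⟫) '' K)

/-- The face `F(P, v) = P ∩ {x : ⟨x, v⟩ = h(P, v)}`. -/
def face {n : ℕ} (P : Set (Rn n)) (v : Rn n) : Set (Rn n) :=
  P ∩ {x | ⟪x, v⟫ = supportFn P v}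

/-- The set `𝒩(P)` of outer unit normals of facets of `P`, i.e. of those unit vectors `v`
for which the face `F(P, v)` has dimension `n - 1`. -/
def facetNormals {n : ℕ} (P : Set (Rn n)) : Set (Rn n) :=
  {v | ‖v‖ = 1 ∧ Module.finrank ℝ (vectorSpan ℝ (face P v)) + 1 = n}

/-- The `(n-1)`-dimensional volume. -/
def facetVol {n : ℕ} (F : Set (Rn n)) : ℝ := (μHE[n - 1] F).toReal

/-! ### The asymmetric `L_p` projection bodies -/

/-- The sum `∑ vol_{n-1}(F(P,v)) h(P,v)^{1-p} τ(⟨v,u⟩)^p` over all `v ∈ 𝒩(P)` with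
`0 ∉ F(P,v)`; it is used for `τ` the positive part and `τ` the negative part. -/
def projSum {n : ℕ} (τ : ℝ → ℝ) (p : ℝ) (P : PolytopeO n) (u : Rn n) : ℝ :=
  ∑ᶠ v ∈ {v : Rn n | v ∈ facetNormals P.1 ∧ (0 : Rn n) ∉ face P.1 v},
    facetVol (face P.1 v) * supportFn P.1 v ^ (1 - p) * τ ⟪v, u⟫ ^ p

/-- The convex body `{x : ⟨x, u⟩ ≤ g(u) for all u}`. If `g` is sublinear, this is the unique
convex body with support function `g`. -/
def bodyOf {n : ℕ} (g : Rn n → ℝ) (hg : ∀ u, 0 ≤ g u) : ConvexBody (Rn n) where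
  carrier := {x | ∀ u, ⟪x, u⟫ ≤ g u}
  convex' := by
    intro x hx y hy a b ha hb hab u
    have h1 := mul_le_mul_of_nonneg_left (hx u) ha
    have h2 := mul_le_mul_of_nonneg_left (hy u) hb
    rw [inner_add_left, real_inner_smul_left, real_inner_smul_left]
    have : g u = a * g u + b * g u := by rw [← add_mul, hab, one_mul]
    linarith
  isCompact' := by
    apply Metric.isCompact_of_isClosed_isBounded
    · simp only [Set.ofPred_forall]
      exact isClosed_iInter fun u => isClosed_le (by fun_prop) continuous_const
    · rw [isBounded_iff_forall_norm_le]
      let e : Fin n → Rn n := fun i => EuclideanSpace.single i (1 : ℝ)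
      refine ⟨∑ i, (g (e i) + g (-e i)), fun x hx => ?_⟩
      have hcoord : ∀ i, |x i| ≤ g (e i) + g (-e i) := by
        intro i
        have h1 := hx (e i)
        have h2 := hx (-e i)
        have h3 : ⟪x, e i⟫ = x i := by simp [e, EuclideanSpace.inner_single_right]
        rw [inner_neg_right] at h2
        rw [h3] at h1 h2
        rw [abs_le]
        constructor <;> linarith [hg (e i), hg (-e i)]
      calc ‖x‖ = ‖∑ i, x i • e i‖ := by
            congr 1
            ext j
            simp [e, Finset.sum_apply, Pi.single_apply]
        _ ≤ ∑ i, ‖x i • e i‖ := norm_sum_le _ _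
        _ ≤ _ := Finset.sum_le_sum fun i _ => by
            simpa [e, norm_smul] using hcoord i
  nonempty' := ⟨0, fun u => by simpa using hg u⟩

theorem supportFn_nonneg {n : ℕ} (P : PolytopeO n) (u : Rn n) : 0 ≤ supportFn P.1 u :=
  Real.sSup_nonneg' ⟨0, ⟨0, P.2.2, by simp⟩, le_rfl⟩

theorem projSum_nonneg {n : ℕ} {τ : ℝ → ℝ} (hτ : ∀ t, 0 ≤ τ t) (p : ℝ) (P : PolytopeO n)
    (u : Rn n) : 0 ≤ projSum τ p P u :=
  finsum_nonneg fun v => finsum_nonneg fun _ =>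
    mul_nonneg (mul_nonneg ENNReal.toReal_nonneg (Real.rpow_nonneg (supportFn_nonneg P v) _))
      (Real.rpow_nonneg (hτ _) _)

/-- The asymmetric `L_p` projection body `Π_p^+ P`: the convex body whose support function is
`u ↦ (∑ vol_{n-1}(F(P,v)) h(P,v)^{1-p} ⟨v,u⟩_+^p)^{1/p}`. -/
def projBodyPos {n : ℕ} (p : ℝ) (P : PolytopeO n) : ConvexBody (Rn n) :=
  bodyOf (fun u => projSum (fun t => max t 0) p P u ^ (1 / p))
    fun u => Real.rpow_nonneg (projSum_nonneg (fun _ => le_max_right _ _) p P u) _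

/-- The asymmetric `L_p` projection body `Π_p^- P`: the convex body whose support function is
`u ↦ (∑ vol_{n-1}(F(P,v)) h(P,v)^{1-p} ⟨v,u⟩_-^p)^{1/p}`. -/
def projBodyNeg {n : ℕ} (p : ℝ) (P : PolytopeO n) : ConvexBody (Rn n) :=
  bodyOf (fun u => projSum (fun t => max (-t) 0) p P u ^ (1 / p))
    fun u => Real.rpow_nonneg (projSum_nonneg (fun _ => le_max_right _ _) p P u) _

/-! ### The support functions of the projection bodies -/

theorem le_supportFn {n : ℕ} (P : PolytopeO n) (v : Rn n) {x : Rn n} (hx : x ∈ P.1) :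
    ⟪x, v⟫ ≤ supportFn P.1 v := by
  obtain ⟨⟨V, hV⟩, -⟩ := P.2
  have hc : IsCompact P.1 := by
    rw [hV]; exact V.finite_toSet.isCompact_convexHull ℝ
  exact le_csSup (hc.image (by fun_prop)).bddAbove ⟨x, hx, rfl⟩

theorem face_eq_convexHull {n : ℕ} (P : PolytopeO n) (V : Finset (Rn n))
    (hV : P.1 = convexHull ℝ (V : Set (Rn n))) (v : Rn n) :
    face P.1 v = convexHull ℝ ((V : Set (Rn n)) ∩ face P.1 v) := by
  have hVP : (V : Set (Rn n)) ⊆ P.1 := hV ▸ subset_convexHull ℝ _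
  apply Set.Subset.antisymm
  · rintro x ⟨hxP, hx⟩
    have hxP' := hxP
    rw [hV, Finset.convexHull_eq] at hxP'
    obtain ⟨w, hw0, hw1, rfl⟩ := hxP'
    have key : ∀ y ∈ V, w y ≠ 0 → y ∈ face P.1 v := by
      have hle : ∀ y ∈ V, w y * ⟪y, v⟫ ≤ w y * supportFn P.1 v := fun y hy =>
        mul_le_mul_of_nonneg_left (le_supportFn P v (hVP hy)) (hw0 y hy)
      have hsum : ∑ y ∈ V, w y * ⟪y, v⟫ = ∑ y ∈ V, w y * supportFn P.1 v := by
        rw [← Finset.sum_mul, hw1, one_mul]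
        have hx' : ⟪V.centerMass w id, v⟫ = supportFn P.1 v := hx
        rw [Finset.centerMass_eq_of_sum_1 _ _ hw1, sum_inner] at hx'
        simpa [real_inner_smul_left] using hx'
      have := (Finset.sum_eq_sum_iff_of_le hle).1 hsum
      intro y hy hne
      exact ⟨hVP hy, mul_left_cancel₀ hne (this y hy)⟩
    rw [← Finset.centerMass_filter_ne_zero (w := w)]
    refine Finset.centerMass_mem_convexHull _ (fun i hi => hw0 i (Finset.mem_filter.1 hi).1) ?_ ?_
    · rw [Finset.sum_filter_ne_zero, hw1]; exact one_pos
    · intro i hi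
      have hi := Finset.mem_filter.1 hi
      exact ⟨hi.1, key i hi.1 hi.2⟩
  · refine convexHull_min Set.inter_subset_right ?_
    intro x hx y hy a b ha hb hab
    refine ⟨?_, ?_⟩
    · have hc : Convex ℝ P.1 := hV ▸ convex_convexHull ℝ _
      exact hc hx.1 hy.1 ha hb hab
    · have h1 : ⟪x, v⟫ = supportFn P.1 v := hx.2
      have h2 : ⟪y, v⟫ = supportFn P.1 v := hy.2
      change ⟪a • x + b • y, v⟫ = supportFn P.1 v
      rw [inner_add_left, real_inner_smul_left, real_inner_smul_left, h1, h2, ← add_mul, hab,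
        one_mul]

theorem vectorSpan_face {n : ℕ} (P : Set (Rn n)) {v : Rn n} (hv : v ∈ facetNormals P) :
    vectorSpan ℝ (face P v) = (ℝ ∙ v)ᗮ := by
  have hv0 : v ≠ 0 := by
    rintro rfl
    simpa using hv.1
  apply Submodule.eq_of_le_of_finrank_eq
  · rw [vectorSpan_def, Submodule.span_le]
    rintro _ ⟨x, hx, y, hy, rfl⟩
    have h1 : ⟪x, v⟫ = supportFn P v := hx.2
    have h2 : ⟪y, v⟫ = supportFn P v := hy.2
    rw [SetLike.mem_coe, Submodule.mem_orthogonal_singleton_iff_inner_left]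
    simp [inner_sub_left, h1, h2]
  · have h1 := Submodule.finrank_add_finrank_orthogonal (ℝ ∙ v)
    rw [finrank_span_singleton hv0, finrank_euclideanSpace_fin] at h1
    have h2 := hv.2
    omega

/-- A polytope has only finitely many facets. -/
theorem facetNormals_finite {n : ℕ} (P : PolytopeO n) : (facetNormals P.1).Finite := by
  obtain ⟨⟨V, hV⟩, -⟩ := P.2
  refine Set.Finite.of_finite_fibers (fun v => (V : Set (Rn n)) ∩ face P.1 v) ?_ ?_
  · refine (V.finite_toSet.powerset).subset ?_
    rintro _ ⟨v, -, rfl⟩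
    exact Set.inter_subset_left
  · rintro _ ⟨v, hv, rfl⟩
    refine (Set.toFinite {v, -v}).subset ?_
    rintro w ⟨hw, hwv⟩
    have hwv' : (V : Set (Rn n)) ∩ face P.1 w = (V : Set (Rn n)) ∩ face P.1 v := hwv
    have hF : face P.1 w = face P.1 v := by
      rw [face_eq_convexHull P V hV w, hwv', ← face_eq_convexHull P V hV v]
    have h1 := vectorSpan_face P.1 hw
    rw [hF, vectorSpan_face P.1 hv] at h1
    have h2 : (ℝ ∙ v) = (ℝ ∙ w) := by
      rw [← Submodule.orthogonal_orthogonal (ℝ ∙ v), h1, Submodule.orthogonal_orthogonal]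
    have h3 : w ∈ (ℝ ∙ v) := h2 ▸ Submodule.mem_span_singleton_self w
    obtain ⟨c, rfl⟩ := Submodule.mem_span_singleton.1 h3
    have h4 : |c| = 1 := by
      have := hw.1
      rwa [norm_smul, hv.1, mul_one, Real.norm_eq_abs] at this
    rcases eq_or_eq_neg_of_abs_eq h4 with h | h <;> simp [h]

theorem supportFn_bodyOf {n : ℕ} (g : Rn n → ℝ) (hg : ∀ u, 0 ≤ g u)
    (hom : ∀ c : ℝ, 0 < c → ∀ u, g (c • u) = c * g u)
    (sub : ∀ u v, g (u + v) ≤ g u + g v) (u : Rn n) :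
    supportFn (bodyOf g hg : Set (Rn n)) u = g u := by
  have hle : ∀ x ∈ (bodyOf g hg : Set (Rn n)), ⟪x, u⟫ ≤ g u := fun x hx => hx u
  suffices h : ∃ x ∈ (bodyOf g hg : Set (Rn n)), ⟪x, u⟫ = g u by
    obtain ⟨x, hx, hxu⟩ := h
    apply le_antisymm
    · exact csSup_le ⟨_, x, hx, rfl⟩ (by rintro _ ⟨y, hy, rfl⟩; exact hle y hy)
    · rw [← hxu]
      exact le_csSup ⟨g u, by rintro _ ⟨y, hy, rfl⟩; exact hle y hy⟩ ⟨x, hx, rfl⟩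
  have g0 : g 0 = 0 := by
    have := hom 2 (by norm_num) 0
    rw [smul_zero] at this
    linarith
  have hfu : ∀ c : ℝ, c • u = 0 → c • g u = 0 := by
    intro c hc
    rcases smul_eq_zero.1 hc with h | h
    · simp [h]
    · simp [h, g0]
  obtain ⟨f, hf1, hf2⟩ := exists_extension_of_le_sublinear
    (LinearPMap.mkSpanSingleton' u (g u) hfu) g hom sub (by
      rintro ⟨x, hx⟩
      obtain ⟨c, rfl⟩ := Submodule.mem_span_singleton.1 hx
      rw [LinearPMap.mkSpanSingleton'_apply]
      change c * g u ≤ g (c • u)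
      rcases lt_trichotomy c 0 with h | h | h
      · exact (mul_nonpos_of_nonpos_of_nonneg h.le (hg u)).trans (hg _)
      · simp [h, g0]
      · rw [hom c h])
  let x : Rn n := (InnerProductSpace.toDual ℝ (Rn n)).symm f.toContinuousLinearMap
  have hx : ∀ w, ⟪x, w⟫ = f w := fun w => by
    simp [x, InnerProductSpace.toDual_symm_apply]
  refine ⟨x, fun w => (hx w).trans_le (hf2 w), ?_⟩
  rw [hx]
  have := hf1 ⟨u, Submodule.mem_span_singleton_self u⟩
  exact this.trans (LinearPMap.mkSpanSingleton'_apply_self u (g u) hfu _)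

theorem supportFn_body_projSum {n : ℕ} {p : ℝ} (hp : 1 < p) {τ : ℝ → ℝ} (hτ : ∀ t, 0 ≤ τ t)
    (hom : ∀ c : ℝ, 0 < c → ∀ t, τ (c * t) = c * τ t) (sub : ∀ s t, τ (s + t) ≤ τ s + τ t)
    (P : PolytopeO n) (u : Rn n) :
    supportFn (bodyOf (fun u => projSum τ p P u ^ (1 / p))
      (fun u => Real.rpow_nonneg (projSum_nonneg hτ p P u) _) : Set (Rn n)) u ^ p
      = projSum τ p P u := by
  have hp0 : 0 < p := by linarith
  have hfin : {v : Rn n | v ∈ facetNormals P.1 ∧ (0 : Rn n) ∉ face P.1 v}.Finite :=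
    (facetNormals_finite P).subset fun v hv => hv.1
  let c : Rn n → ℝ := fun v => facetVol (face P.1 v) * supportFn P.1 v ^ (1 - p)
  have hc : ∀ v, 0 ≤ c v := fun v =>
    mul_nonneg ENNReal.toReal_nonneg (Real.rpow_nonneg (supportFn_nonneg P v) _)
  have hterm : ∀ v t, 0 ≤ t → c v * t ^ p = (c v ^ (1 / p) * t) ^ p := by
    intro v t ht
    rw [Real.mul_rpow (Real.rpow_nonneg (hc v) _) ht, ← Real.rpow_mul (hc v),
      one_div_mul_cancel hp0.ne', Real.rpow_one]
  have hsum : ∀ u, projSum τ p P u =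
      ∑ v ∈ hfin.toFinset, (c v ^ (1 / p) * τ ⟪v, u⟫) ^ p := by
    intro u
    rw [projSum, finsum_mem_eq_finite_toFinset_sum _ hfin]
    exact Finset.sum_congr rfl fun v _ => hterm v _ (hτ _)
  rw [supportFn_bodyOf, ← Real.rpow_mul (projSum_nonneg hτ p P u), one_div_mul_cancel hp0.ne',
    Real.rpow_one]
  · intro r hr u
    have : projSum τ p P (r • u) = r ^ p * projSum τ p P u := by
      rw [hsum, hsum, Finset.mul_sum]
      refine Finset.sum_congr rfl fun v _ => ?_
      rw [real_inner_smul_right, hom r hr, ← Real.mul_rpow hr.le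
        (mul_nonneg (Real.rpow_nonneg (hc v) _) (hτ _))]
      congr 1
      ring
    rw [this, Real.mul_rpow (Real.rpow_nonneg hr.le _) (projSum_nonneg hτ p P u),
      ← Real.rpow_mul hr.le, mul_one_div_cancel hp0.ne', Real.rpow_one]
  · intro u w
    simp only [hsum]
    refine le_trans ?_ (Real.Lp_add_le_of_nonneg hfin.toFinset hp.le
      (fun v _ => mul_nonneg (Real.rpow_nonneg (hc v) _) (hτ _))
      (fun v _ => mul_nonneg (Real.rpow_nonneg (hc v) _) (hτ _)))
    refine Real.rpow_le_rpow (Finset.sum_nonneg fun v _ => Real.rpow_nonneg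
      (mul_nonneg (Real.rpow_nonneg (hc v) _) (hτ _)) _) ?_ (by positivity)
    refine Finset.sum_le_sum fun v _ => Real.rpow_le_rpow
      (mul_nonneg (Real.rpow_nonneg (hc v) _) (hτ _)) ?_ hp0.le
    rw [← mul_add, inner_add_right]
    exact mul_le_mul_of_nonneg_left (sub _ _) (Real.rpow_nonneg (hc v) _)

/-- The defining identity of `Π_p^+ P`. -/
theorem supportFn_projBodyPos {n : ℕ} {p : ℝ} (hp : 1 < p) (P : PolytopeO n) (u : Rn n) :
    supportFn (projBodyPos p P : Set (Rn n)) u ^ p = projSum (fun t => max t 0) p P u := by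
  refine supportFn_body_projSum hp (fun _ => le_max_right _ _) ?_ ?_ P u
  · intro c hc t
    rw [mul_max_of_nonneg _ _ hc.le, mul_zero]
  · intro s t
    exact max_le (add_le_add (le_max_left _ _) (le_max_left _ _))
      (add_nonneg (le_max_right _ _) (le_max_right _ _))

/-- The defining identity of `Π_p^- P`. -/
theorem supportFn_projBodyNeg {n : ℕ} {p : ℝ} (hp : 1 < p) (P : PolytopeO n) (u : Rn n) :
    supportFn (projBodyNeg p P : Set (Rn n)) u ^ p = projSum (fun t => max (-t) 0) p P u := by
  refine supportFn_body_projSum hp (fun _ => le_max_right _ _) ?_ ?_ P u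
  · intro c hc t
    rw [mul_max_of_nonneg _ _ hc.le, mul_zero, mul_neg]
  · intro s t
    rw [neg_add]
    exact max_le (add_le_add (le_max_left _ _) (le_max_left _ _))
      (add_nonneg (le_max_right _ _) (le_max_right _ _))

end LpVal

end

noncomputable section

namespace LpVal

/-! ### Cutting polytopes by halfspaces -/

/-! For fixed `u`, both `P ↦ Φ P u` and the sums defining the projection bodies are additive under
cuts by hyperplanes through the origin. A cut-additive functional that vanishes in dimension below
`k` and on `k`-simplices with a vertex at the origin vanishes in dimension `k`
(`IsCutAdditive.eq_zero`): refine a simplicial cone until a single facet inequality bounds `P` in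
each subcone, so that every full-dimensional piece is such a simplex. It therefore suffices to
compare the two sides in low dimension and on simplices.

In codimension at least two, transvections fixing `P` pointwise carry `x` to `2x`, so `Φ P (2x) = Φ
P x`, and homogeneity of degree `p > 1` forces zero. In codimension one, bisecting a simplex along
an edge gives two `SL(n)`-images of it, so `Φ P (2x) = 2 Φ P x`, which again forces zero because `2
^ p > 2` (`vanishesBelow_dim`).

On `n`-simplices contravariance leaves one function: `Φ (A Tⁿ) (A x) = F (det A) x`. Splitting an
edge gives a functional equation for `F` (`IsProfile`). Evaluating a vector with three nonzero
coordinates of one sign in different orders, together with continuity, makes `t ↦ F t (σ eᵢ)`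
additive (`IsProfile.additive`). A nonlinear additive function has a graph dense in the half-plane,
so the non-density hypothesis makes it linear (`linear_of_not_dense`). The functional equation then
propagates the values from the axes to all of space, giving `F t x = t (c₁ (∑ xᵢ)₊ ^ p + c₂ (∑ xᵢ)₋
^ p)` (`IsProfile.classification`).

On `A Tⁿ` the projection sums have the same form up to one positive constant
(`projSum_map_stdSimplexO`), because only the facet opposite the origin contributes. The difference
of the two sides thus vanishes on simplices, hence everywhere. -/

/-- The generators are the points of `V` in the halfspace and the points where segments from them to
the remaining points of `V` meet `l = 0`. -/
theorem exists_convexHull_inter_halfspace {E : Type*} [AddCommGroup E] [Module ℝ E]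
    (V : Finset E) (l : E →ₗ[ℝ] ℝ) :
    ∃ W : Finset E, convexHull ℝ (V : Set E) ∩ {x | 0 ≤ l x} = convexHull ℝ (W : Set E) := by
  classical
  set A := V.filter fun v => 0 ≤ l v with hA
  set B := V.filter fun v => ¬ 0 ≤ l v with hB
  let c : E × E → E := fun q => (l q.1 - l q.2)⁻¹ • (l q.1 • q.2 - l q.2 • q.1)
  refine ⟨A ∪ (A ×ˢ B).image c, Set.Subset.antisymm ?_ ?_⟩
  · rintro x ⟨hx, hlx⟩
    have hlx : 0 ≤ l x := hlx
    rw [Finset.convexHull_eq] at hx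
    obtain ⟨w, hw0, hw1, rfl⟩ := hx
    rw [Finset.centerMass_eq_of_sum_1 _ _ hw1] at hlx ⊢
    simp only [id] at hlx ⊢
    have hAm : ∀ v ∈ A, v ∈ V ∧ 0 ≤ l v := fun v hv => Finset.mem_filter.1 hv
    have hBm : ∀ v ∈ B, v ∈ V ∧ l v < 0 := fun v hv => by
      have := Finset.mem_filter.1 hv
      exact ⟨this.1, not_le.1 this.2⟩
    have split : ∀ f : E → ℝ, ∑ v ∈ V, f v = ∑ v ∈ A, f v + ∑ v ∈ B, f v := fun f =>
      (Finset.sum_filter_add_sum_filter_not V _ f).symm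
    have splitE : ∀ f : E → E, ∑ v ∈ V, f v = ∑ v ∈ A, f v + ∑ v ∈ B, f v := fun f =>
      (Finset.sum_filter_add_sum_filter_not V _ f).symm
    set a := ∑ v ∈ A, w v * l v with ha
    set b := ∑ v ∈ B, w v * (-l v) with hb
    have hab : b ≤ a := by
      rw [map_sum, split] at hlx
      simp only [map_smul, smul_eq_mul] at hlx
      have : ∑ v ∈ B, w v * l v = -b := by
        rw [hb, ← Finset.sum_neg_distrib]; exact Finset.sum_congr rfl fun v _ => by ring
      rw [this] at hlx
      linarith
    have hb0 : 0 ≤ b := Finset.sum_nonneg fun v hv =>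
      mul_nonneg (hw0 v (hBm v hv).1) (by linarith [(hBm v hv).2])
    have hAW : ∀ v ∈ A, v ∈ convexHull ℝ ((A ∪ (A ×ˢ B).image c : Finset E) : Set E) :=
      fun v hv => subset_convexHull ℝ _ (by exact_mod_cast Finset.mem_union_left _ hv)
    rcases eq_or_lt_of_le (hb0.trans hab) with ha0 | ha0
    · have hb00 : b = 0 := by linarith
      have hz : ∀ v ∈ B, w v = 0 := by
        intro v hv
        have := (Finset.sum_eq_zero_iff_of_nonneg (fun v hv =>
          mul_nonneg (hw0 v (hBm v hv).1) (by linarith [(hBm v hv).2]))).1 hb00 v hv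
        rcases mul_eq_zero.1 this with h | h
        · exact h
        · linarith [(hBm v hv).2]
      rw [splitE, Finset.sum_eq_zero (s := B) (fun v hv => by rw [hz v hv, zero_smul]), add_zero]
      rw [split, Finset.sum_eq_zero (s := B) (fun v hv => hz v hv), add_zero] at hw1
      exact (convex_convexHull ℝ _).sum_mem (fun v hv => hw0 v (hAm v hv).1) hw1 hAW
    · have hne : ∀ v ∈ A, ∀ u ∈ B, l v - l u ≠ 0 := fun v hv u hu => by
        linarith [(hAm v hv).2, (hBm u hu).2] |> fun h : 0 < l v - l u => h.ne'
      -- The crossing points absorb all the mass of the negative points and the fraction `b / a` of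
      -- the mass of the nonnegative ones; the rest stays in place.
      let W : E ⊕ (E × E) → ℝ := Sum.elim (fun v => w v * (1 - b / a))
        (fun q => w q.1 * w q.2 * (l q.1 - l q.2) / a)
      let z : E ⊕ (E × E) → E := Sum.elim id c
      have key : ∑ i ∈ A.disjSum (A ×ˢ B), W i • z i = ∑ v ∈ V, w v • v := by
        rw [Finset.sum_disjSum, splitE, Finset.sum_product]
        simp only [W, z, Sum.elim_inl, Sum.elim_inr, id]
        have h1 : ∑ v ∈ A, ∑ u ∈ B, (w v * w u * (l v - l u) / a) • c (v, u)
            = (b / a) • ∑ v ∈ A, w v • v + ∑ u ∈ B, w u • u := by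
          have : ∀ v ∈ A, ∀ u ∈ B, (w v * w u * (l v - l u) / a) • c (v, u)
              = (w u * -l u) • ((a⁻¹ * w v) • v) + (w v * l v) • ((a⁻¹ * w u) • u) := by
            intro v hv u hu
            simp only [c, smul_smul, smul_sub]
            rw [sub_eq_add_neg, add_comm, ← neg_smul]
            have := hne v hv u hu
            congr 2 <;> field_simp
          rw [Finset.sum_congr rfl fun v hv => Finset.sum_congr rfl fun u hu => this v hv u hu]
          simp only [Finset.sum_add_distrib]
          congr 1
          · simp only [← Finset.sum_smul, ← hb]
            rw [Finset.smul_sum]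
            refine Finset.sum_congr rfl fun v _ => ?_
            rw [smul_smul, smul_smul]; congr 1; field_simp
          · rw [Finset.sum_comm]
            simp only [← Finset.sum_smul, ← ha]
            refine Finset.sum_congr rfl fun v _ => ?_
            rw [smul_smul]; congr 1; field_simp
        rw [h1, ← add_assoc, Finset.smul_sum, ← Finset.sum_add_distrib]
        congr 1
        refine Finset.sum_congr rfl fun v _ => ?_
        rw [smul_smul, ← add_smul]; congr 1; ring
      have hW1 : ∑ i ∈ A.disjSum (A ×ˢ B), W i = 1 := by
        rw [Finset.sum_disjSum, Finset.sum_product, ← hw1, split]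
        simp only [W, Sum.elim_inl, Sum.elim_inr]
        have h1 : ∑ v ∈ A, ∑ u ∈ B, w v * w u * (l v - l u) / a
            = (b / a) * ∑ v ∈ A, w v + ∑ u ∈ B, w u := by
          have : ∀ v ∈ A, ∀ u ∈ B, w v * w u * (l v - l u) / a
              = (w u * -l u) * (a⁻¹ * w v) + (w v * l v) * (a⁻¹ * w u) := by
            intro v hv u hu
            field_simp; ring
          rw [Finset.sum_congr rfl fun v hv => Finset.sum_congr rfl fun u hu => this v hv u hu]
          simp only [Finset.sum_add_distrib]
          congr 1
          · simp only [← Finset.sum_mul, ← hb]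
            rw [Finset.mul_sum]
            refine Finset.sum_congr rfl fun v _ => ?_
            field_simp
          · rw [Finset.sum_comm]
            simp only [← Finset.sum_mul, ← ha]
            refine Finset.sum_congr rfl fun v _ => ?_
            field_simp
        rw [h1, ← add_assoc, Finset.mul_sum, ← Finset.sum_add_distrib]
        congr 1
        refine Finset.sum_congr rfl fun v _ => ?_
        ring
      rw [← key]
      refine (convex_convexHull ℝ _).sum_mem ?_ hW1 ?_
      · rintro (v | q) hi
        · have hv : v ∈ A := by simpa using hi
          exact mul_nonneg (hw0 v (hAm v hv).1) (by
            rw [sub_nonneg, div_le_one ha0]; exact hab)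
        · have hq : q.1 ∈ A ∧ q.2 ∈ B := by simpa [Finset.mem_product] using hi
          refine div_nonneg (mul_nonneg (mul_nonneg (hw0 _ (hAm _ hq.1).1)
            (hw0 _ (hBm _ hq.2).1)) ?_) ha0.le
          linarith [(hAm _ hq.1).2, (hBm _ hq.2).2]
      · rintro (v | q) hi
        · exact hAW v (by simpa using hi)
        · have hq : q ∈ A ×ˢ B := by simpa using hi
          refine subset_convexHull ℝ _ ?_
          exact_mod_cast Finset.mem_union_right _ (Finset.mem_image_of_mem c hq)
  · refine convexHull_min ?_ ((convex_convexHull ℝ _).inter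
      (convex_halfSpace_ge l.isLinear 0))
    intro x hx
    rcases Finset.mem_union.1 (by exact_mod_cast hx) with hx | hx
    · have := Finset.mem_filter.1 hx
      exact ⟨subset_convexHull ℝ _ (by exact_mod_cast this.1), this.2⟩
    · obtain ⟨⟨v, u⟩, hq, rfl⟩ := Finset.mem_image.1 hx
      have hq := Finset.mem_product.1 hq
      have hv := Finset.mem_filter.1 hq.1
      have hu := Finset.mem_filter.1 hq.2
      have hu2 : l u < 0 := not_le.1 hu.2
      have hv2 : 0 ≤ l v := hv.2
      have hpos : 0 < l v - l u := by linarith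
      constructor
      · have : c (v, u) = (l v / (l v - l u)) • u + (-l u / (l v - l u)) • v := by
          simp only [c, smul_sub, smul_smul]
          rw [sub_eq_add_neg, ← neg_smul]
          congr 2 <;> ring
        rw [this]
        refine convex_convexHull ℝ _ (subset_convexHull ℝ _ (by exact_mod_cast hu.1))
          (subset_convexHull ℝ _ (by exact_mod_cast hv.1)) (by positivity)
          (div_nonneg (by linarith) hpos.le) ?_
        field_simp; ring
      · have : l (c (v, u)) = 0 := by
          simp only [c, map_smul, map_sub, smul_eq_mul]; ring
        exact this.ge

/-- The part of a polytope on which the linear functional `l` is nonnegative. -/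
def PolytopeO.cut {n : ℕ} (P : PolytopeO n) (l : Rn n →ₗ[ℝ] ℝ) : PolytopeO n :=
  ⟨P.1 ∩ {x | 0 ≤ l x}, by
    obtain ⟨⟨V, hV⟩, h0⟩ := P.2
    obtain ⟨W, hW⟩ := exists_convexHull_inter_halfspace V l
    exact ⟨⟨W, by rw [hV, hW]⟩, h0, by simp⟩⟩

theorem PolytopeO.mem_cut {n : ℕ} {P : PolytopeO n} {l : Rn n →ₗ[ℝ] ℝ} {x : Rn n} :
    x ∈ (P.cut l).1 ↔ x ∈ P.1 ∧ 0 ≤ l x := Iff.rfl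

theorem PolytopeO.convex {n : ℕ} (P : PolytopeO n) : Convex ℝ P.1 := by
  obtain ⟨⟨V, hV⟩, -⟩ := P.2
  exact hV ▸ convex_convexHull ℝ _

theorem PolytopeO.isCompact {n : ℕ} (P : PolytopeO n) : IsCompact P.1 := by
  obtain ⟨⟨V, hV⟩, -⟩ := P.2
  rw [hV]; exact V.finite_toSet.isCompact_convexHull ℝ

/-- The simplex with vertices `0` and `b i`. -/
def simplexO {n k : ℕ} (b : Fin k → Rn n) : PolytopeO n :=
  ⟨convexHull ℝ (insert 0 (Set.range b)), by
    classical
    exact ⟨⟨insert 0 (Finset.univ.image b), by simp⟩,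
      subset_convexHull ℝ _ (Set.mem_insert _ _)⟩⟩

theorem mem_simplexO {n k : ℕ} {b : Fin k → Rn n} {x : Rn n} :
    x ∈ (simplexO b).1 ↔ ∃ c : Fin k → ℝ, (∀ i, 0 ≤ c i) ∧ ∑ i, c i ≤ 1 ∧
      ∑ i, c i • b i = x := by
  constructor
  · intro hx
    have hconv : Convex ℝ {x : Rn n | ∃ c : Fin k → ℝ, (∀ i, 0 ≤ c i) ∧ ∑ i, c i ≤ 1 ∧
      ∑ i, c i • b i = x} := by
      rintro _ ⟨c, hc, hc1, rfl⟩ _ ⟨d, hd, hd1, rfl⟩ s t hs ht hst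
      refine ⟨fun i => s * c i + t * d i, fun i => by have := hc i; have := hd i; positivity,
        ?_, ?_⟩
      · rw [Finset.sum_add_distrib, ← Finset.mul_sum, ← Finset.mul_sum]
        nlinarith
      · simp only [add_smul, Finset.sum_add_distrib, mul_smul, Finset.smul_sum]
    refine convexHull_min ?_ hconv hx
    rintro y (rfl | ⟨i, rfl⟩)
    · exact ⟨0, by simp, by simp, by simp⟩
    · exact ⟨Pi.single i 1, fun j => by by_cases h : j = i <;> simp [h],
        by simp, by simp [Pi.single_apply]⟩
  · rintro ⟨c, hc, hc1, rfl⟩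
    have hP : Convex ℝ (simplexO b).1 := convex_convexHull ℝ _
    have h0 : (0 : Rn n) ∈ (simplexO b).1 := (simplexO b).2.2
    have := hP.sum_mem (t := Finset.univ) (w := fun o : Option (Fin k) => o.elim (1 - ∑ i, c i) c)
      (z := fun o => o.elim 0 b) ?_ ?_ ?_
    · simpa [Fintype.sum_option] using this
    · rintro (_ | i) -
      · simpa using hc1
      · exact hc i
    · simp [Fintype.sum_option]
    · rintro (_ | i) -
      · exact h0
      · exact subset_convexHull ℝ _ (Set.mem_insert_of_mem _ ⟨i, rfl⟩)

theorem PolytopeO.map_simplexO {n k : ℕ} (A : Rn n →ₗ[ℝ] Rn n) (b : Fin k → Rn n) :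
    (simplexO b).map A = simplexO (fun i => A (b i)) := by
  refine Subtype.ext ?_
  change A '' convexHull ℝ _ = convexHull ℝ _
  rw [LinearMap.image_convexHull, Set.image_insert_eq, map_zero, ← Set.range_comp]
  rfl

/-! ### Halfspace representation of polytopes -/

theorem exists_between_of_forall_le {ι κ : Type*} (s : Finset ι) (t : Finset κ) (f : ι → ℝ)
    (g : κ → ℝ) (hs : s.Nonempty) (h : ∀ i ∈ s, ∀ j ∈ t, f i ≤ g j) :
    ∃ r, (∀ i ∈ s, f i ≤ r) ∧ ∀ j ∈ t, r ≤ g j := by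
  obtain ⟨i, hi, him⟩ := s.exists_max_image f hs
  exact ⟨f i, him, fun j hj => h i hi j hj⟩

/-- A finitely generated cone is an intersection of finitely many halfspaces. -/
theorem exists_dual_of_finite_generators {E : Type*} [AddCommGroup E] [Module ℝ E]
    [FiniteDimensional ℝ E] (V : Finset E) :
    ∃ W : Finset (E →ₗ[ℝ] ℝ), ∀ x, (∃ c : E → ℝ, (∀ v ∈ V, 0 ≤ c v) ∧ ∑ v ∈ V, c v • v = x) ↔
      ∀ w ∈ W, 0 ≤ w x := by
  classical
  induction V using Finset.induction_on with
  | empty =>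
    let b := Module.finBasis ℝ E
    refine ⟨Finset.univ.image (fun i => b.coord i) ∪ Finset.univ.image (fun i => -b.coord i),
      fun x => ?_⟩
    simp only [Finset.notMem_empty, false_imp_iff, implies_true, Finset.sum_empty, true_and,
      exists_const, Finset.mem_union, Finset.mem_image, Finset.mem_univ]
    constructor
    · rintro rfl w -
      simp
    · intro h
      refine (b.ext_elem fun i => ?_).symm
      have h1 := h (b.coord i) (Or.inl ⟨i, rfl⟩)
      have h2 := h (-b.coord i) (Or.inr ⟨i, rfl⟩)
      simp at h1 h2 ⊢
      linarith
  | insert u V hu ih =>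
    obtain ⟨W, hW⟩ := ih
    -- Fourier–Motzkin elimination of `t ≥ 0` from the inequalities `0 ≤ w x - t * w u`. Those with
    -- `w u > 0` bound `t` from above, and they also enter `W0`, where they are combined with `t ≥
    -- 0`.
    let W0 := W.filter fun w => 0 ≤ w u
    let Wp := W.filter fun w => 0 < w u
    let Wn := W.filter fun w => w u < 0
    refine ⟨W0 ∪ (Wp ×ˢ Wn).image (fun q => q.1 u • q.2 - q.2 u • q.1), fun x => ?_⟩
    have h1 : (∃ c : E → ℝ, (∀ v ∈ insert u V, 0 ≤ c v) ∧ ∑ v ∈ insert u V, c v • v = x) ↔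
        ∃ t : ℝ, 0 ≤ t ∧ ∀ w ∈ W, 0 ≤ w (x - t • u) := by
      constructor
      · rintro ⟨c, hc, rfl⟩
        refine ⟨c u, hc u (Finset.mem_insert_self _ _), (hW _).1 ⟨c, fun v hv =>
          hc v (Finset.mem_insert_of_mem hv), ?_⟩⟩
        rw [Finset.sum_insert hu]; abel
      · rintro ⟨t, ht, h⟩
        obtain ⟨c, hc, hcx⟩ := (hW _).2 h
        refine ⟨Function.update c u t, fun v hv => ?_, ?_⟩
        · rcases Finset.mem_insert.1 hv with rfl | hv
          · simpa
          · rw [Function.update_of_ne (ne_of_mem_of_not_mem hv hu)]; exact hc v hv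
        · rw [Finset.sum_insert hu, Function.update_self,
            Finset.sum_congr rfl (g := fun v => c v • v), hcx]
          · abel
          · intro v hv
            rw [Function.update_of_ne (ne_of_mem_of_not_mem hv hu)]
    rw [h1]
    simp only [map_sub, map_smul, smul_eq_mul]
    constructor
    · rintro ⟨t, ht, h⟩ w hw
      rcases Finset.mem_union.1 hw with hw | hw
      · have hw := Finset.mem_filter.1 hw
        have := h w hw.1
        have := mul_nonneg ht hw.2
        linarith
      · obtain ⟨⟨p, q⟩, hpq, rfl⟩ := Finset.mem_image.1 hw
        have hpq := Finset.mem_product.1 hpq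
        have hp := Finset.mem_filter.1 hpq.1
        have hq := Finset.mem_filter.1 hpq.2
        have e1 := mul_nonneg hp.2.le (h q hq.1)
        have e2 := mul_nonneg (neg_nonneg.2 hq.2.le) (h p hp.1)
        simp only [LinearMap.sub_apply, LinearMap.smul_apply, smul_eq_mul]
        nlinarith
    · intro h
      -- The zero functional contributes the quotient `0 / 0 = 0`, which encodes the lower bound `t
      -- ≥ 0`.
      obtain ⟨t, ht1, ht2⟩ := exists_between_of_forall_le (insert 0 Wn) Wp
        (fun w => w x / w u) (fun w => w x / w u) ⟨0, Finset.mem_insert_self _ _⟩ (by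
          intro q hq p hp
          have hp' := Finset.mem_filter.1 hp
          rcases Finset.mem_insert.1 hq with rfl | hq
          · simp only [LinearMap.zero_apply, div_zero]
            exact div_nonneg (h p (Finset.mem_union_left _ (Finset.mem_filter.2
              ⟨hp'.1, hp'.2.le⟩))) hp'.2.le
          · have hq' := Finset.mem_filter.1 hq
            have := h _ (Finset.mem_union_right _ (Finset.mem_image_of_mem _
              (Finset.mem_product.2 ⟨hp, hq⟩ : (p, q) ∈ Wp ×ˢ Wn)))
            simp only [LinearMap.sub_apply, LinearMap.smul_apply, smul_eq_mul] at this
            rw [div_le_iff_of_neg hq'.2, div_mul_eq_mul_div, div_le_iff₀ hp'.2]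
            linarith)
      refine ⟨t, by simpa using ht1 0 (Finset.mem_insert_self _ _), fun w hw => ?_⟩
      rcases lt_trichotomy (w u) 0 with h0 | h0 | h0
      · have := ht1 w (Finset.mem_insert_of_mem (Finset.mem_filter.2 ⟨hw, h0⟩))
        rw [div_le_iff_of_neg h0] at this
        linarith
      · have := h w (Finset.mem_union_left _ (Finset.mem_filter.2 ⟨hw, h0.ge⟩))
        rw [h0]; linarith
      · have := ht2 w (Finset.mem_filter.2 ⟨hw, h0⟩)
        rw [le_div_iff₀ h0] at this
        linarith

/-- A polytope is an intersection of finitely many halfspaces `{w ≤ c}`. -/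
theorem PolytopeO.exists_halfspaces {n : ℕ} (P : PolytopeO n) :
    ∃ W : Finset ((Rn n →ₗ[ℝ] ℝ) × ℝ), (∀ w ∈ W, 0 ≤ w.2) ∧ ∀ x, x ∈ P.1 ↔ ∀ w ∈ W, w.1 x ≤ w.2 := by
  classical
  obtain ⟨⟨V, hV⟩, h0⟩ := P.2
  -- Homogenization: `P` is the section at height `1` of the cone over `V × {1}`.
  obtain ⟨W, hW⟩ := exists_dual_of_finite_generators (V.image fun v => ((v, 1) : Rn n × ℝ))
  let f : (Rn n × ℝ →ₗ[ℝ] ℝ) → (Rn n →ₗ[ℝ] ℝ) × ℝ := fun w =>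
    (-(w ∘ₗ LinearMap.inl ℝ (Rn n) ℝ), w (0, 1))
  have hmem : ∀ x, x ∈ P.1 ↔ ∀ w ∈ W.image f, w.1 x ≤ w.2 := by
    intro x
    have h1 : x ∈ P.1 ↔ ∀ w ∈ W, 0 ≤ w (x, 1) := by
      rw [← hW, hV]
      constructor
      · intro hx
        rw [Finset.convexHull_eq] at hx
        obtain ⟨w, hw0, hw1, rfl⟩ := hx
        rw [Finset.centerMass_eq_of_sum_1 _ _ hw1]
        refine ⟨fun q => w q.1, ?_, ?_⟩
        · intro q hq
          obtain ⟨v, hv, rfl⟩ := Finset.mem_image.1 hq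
          exact hw0 v hv
        · rw [Finset.sum_image (fun a _ b _ h => (Prod.ext_iff.1 h).1)]
          ext1
          · simp [Prod.fst_sum]
          · simp [Prod.snd_sum, hw1]
      · rintro ⟨c, hc, hcx⟩
        rw [Finset.sum_image (fun a _ b _ h => (Prod.ext_iff.1 h).1)] at hcx
        have e1 := congrArg Prod.fst hcx
        have e2 := congrArg Prod.snd hcx
        simp only [Prod.fst_sum, Prod.snd_sum, Prod.smul_mk, smul_eq_mul, mul_one] at e1 e2
        rw [← e1]
        exact (convex_convexHull ℝ _).sum_mem (fun v hv => hc _ (Finset.mem_image_of_mem _ hv)) e2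
          fun v hv => subset_convexHull ℝ _ hv
    rw [h1]
    simp only [Finset.forall_mem_image, f, LinearMap.neg_apply, LinearMap.comp_apply,
      LinearMap.inl_apply]
    refine forall₂_congr fun w _ => ?_
    have : w (x, 1) = w (x, 0) + w (0, 1) := by rw [← map_add]; simp
    rw [this]
    constructor <;> intro h <;> linarith
  refine ⟨W.image f, fun w hw => ?_, hmem⟩
  simpa using (hmem 0).1 h0 w hw

/-! ### Splitting simplicial cones and simplices along an edge -/

theorem sum_smul_update {ι E : Type*} [Fintype ι] [DecidableEq ι] [AddCommGroup E] [Module ℝ E]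
    (c : ι → ℝ) (b : ι → E) (j : ι) (m : E) :
    ∑ l, c l • Function.update b j m l = ∑ l, c l • b l + c j • (m - b j) := by
  have : Function.update b j m = b + Pi.single j (m - b j) := by
    ext l
    by_cases h : l = j
    · subst h; simp
    · simp [h]
  rw [this]
  simp only [Pi.add_apply, smul_add, Finset.sum_add_distrib]
  congr 1
  rw [Finset.sum_eq_single j] <;> simp +contextual

theorem sum_add_single_smul {ι E : Type*} [Fintype ι] [DecidableEq ι] [AddCommGroup E] [Module ℝ E]
    (c : ι → ℝ) (b : ι → E) (i j : ι) (s t : ℝ) :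
    ∑ l, (c + Pi.single i s + Pi.single j t : ι → ℝ) l • b l
      = ∑ l, c l • b l + s • b i + t • b j := by
  simp only [Pi.add_apply, add_smul, Finset.sum_add_distrib]
  congr 1
  · congr 1
    rw [Finset.sum_eq_single i] <;> simp +contextual
  · rw [Finset.sum_eq_single j] <;> simp +contextual

theorem sum_add_single {ι : Type*} [Fintype ι] [DecidableEq ι]
    (c : ι → ℝ) (i j : ι) (s t : ℝ) :
    ∑ l, (c + Pi.single i s + Pi.single j t : ι → ℝ) l = ∑ l, c l + s + t := by
  simpa using sum_add_single_smul c (fun _ => (1 : ℝ)) i j s t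

theorem linearIndependent_update_edge {ι E : Type*} [Fintype ι] [DecidableEq ι] [AddCommGroup E]
    [Module ℝ E] {b : ι → E} (hb : LinearIndependent ℝ b) {i j : ι} (hij : i ≠ j) {α β : ℝ}
    (hβ : β ≠ 0) : LinearIndependent ℝ (Function.update b j (α • b i + β • b j)) := by
  rw [Fintype.linearIndependent_iff] at hb ⊢
  intro g hg
  rw [sum_smul_update] at hg
  have h := hb (g + Pi.single i (g j * α) + Pi.single j (g j * (β - 1))) (by
    rw [sum_add_single_smul, ← hg]
    module)
  have hj : g j = 0 := by
    have := h j
    simp [hij.symm] at this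
    have h2 : g j * β = 0 := by linarith
    exact (mul_eq_zero.1 h2).resolve_right hβ
  intro l
  simpa [hj] using h l

/-- New coefficients `(cᵢ, cⱼ)` correspond to old ones `(cᵢ + α cⱼ, β cⱼ)`, and the inverse change
keeps nonnegativity exactly when `β cᵢ ≥ α cⱼ`, which is what `η` measures. The predicate `Q` treats
cones (always true) and simplices (coefficient sum at most `1`, preserved when `α + β = 1`)
together. -/
theorem edge_split_iff {ι E : Type*} [Fintype ι] [DecidableEq ι] [AddCommGroup E]
    [Module ℝ E] (b : ι → E) {i j : ι} (hij : i ≠ j) {α β : ℝ} (hα : 0 < α)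
    (hβ : 0 < β) (η : E →ₗ[ℝ] ℝ) (hi : η (b i) = β) (hj : η (b j) = -α)
    (hl : ∀ l, l ≠ i → l ≠ j → η (b l) = 0) (Q : ℝ → Prop)
    (hQ : α + β = 1 ∨ ∀ s, Q s) (x : E) :
    (∃ c : ι → ℝ, (∀ l, 0 ≤ c l) ∧ Q (∑ l, c l) ∧
        ∑ l, c l • Function.update b j (α • b i + β • b j) l = x) ↔
      (∃ c : ι → ℝ, (∀ l, 0 ≤ c l) ∧ Q (∑ l, c l) ∧ ∑ l, c l • b l = x) ∧ 0 ≤ η x := by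
  constructor
  · rintro ⟨c, hc, hQc, rfl⟩
    refine ⟨⟨c + Pi.single i (c j * α) + Pi.single j (c j * (β - 1)), fun l => ?_, ?_, ?_⟩, ?_⟩
    · by_cases h1 : l = i
      · subst h1
        have := hc l; have := mul_nonneg (hc j) hα.le
        simp [hij]; linarith
      · by_cases h2 : l = j
        · subst h2
          simp [h1]; nlinarith [mul_nonneg (hc l) hβ.le]
        · simp [h1, h2, hc]
    · rcases hQ with hQ | hQ
      · rw [sum_add_single]
        convert hQc using 1
        have : c j * α + c j * (β - 1) = c j * (α + β - 1) := by ring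
        rw [add_assoc, this, hQ]; ring
      · exact hQ _
    · rw [sum_add_single_smul, sum_smul_update]; module
    · rw [map_sum]
      refine Finset.sum_nonneg fun l _ => ?_
      rw [map_smul, smul_eq_mul]
      refine mul_nonneg (hc l) ?_
      by_cases h2 : l = j
      · subst h2
        simp [hi, hj]; nlinarith
      · rw [Function.update_of_ne h2]
        by_cases h1 : l = i
        · subst h1; rw [hi]; exact hβ.le
        · exact (hl l h1 h2).ge
  · rintro ⟨⟨c, hc, hQc, rfl⟩, hη⟩
    have hη' : 0 ≤ β * c i - α * c j := by
      rw [map_sum] at hη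
      simp only [map_smul, smul_eq_mul] at hη
      rw [Fintype.sum_eq_add i j hij] at hη
      · rw [hi, hj] at hη; linarith
      · rintro l ⟨h1, h2⟩
        rw [hl l h1 h2, mul_zero]
    refine ⟨c + Pi.single i (-(α * c j / β)) + Pi.single j (c j / β - c j), fun l => ?_, ?_, ?_⟩
    · by_cases h1 : l = i
      · subst h1
        have : α * c j / β ≤ c l := by rw [div_le_iff₀ hβ]; linarith
        simp [hij]; linarith
      · by_cases h2 : l = j
        · subst h2
          have := div_nonneg (hc l) hβ.le
          simpa [h1] using this
        · simp [h1, h2, hc]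
    · rcases hQ with hQ | hQ
      · rw [sum_add_single]
        convert hQc using 1
        have : α = 1 - β := by linarith
        rw [this]; field_simp; ring
      · exact hQ _
    · rw [sum_smul_update, sum_add_single_smul]
      have : (c + Pi.single i (-(α * c j / β)) + Pi.single j (c j / β - c j) : ι → ℝ) j
          = c j / β := by simp [hij.symm]
      rw [this, smul_sub, smul_add, smul_smul, smul_smul, div_mul_cancel₀ _ hβ.ne']
      have h3 : c j / β * α = α * c j / β := by ring
      rw [h3]
      module

/-- The cone generated by the vectors `b i`. -/
def posCone {n k : ℕ} (b : Fin k → Rn n) : Set (Rn n) :=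
  {x | ∃ c : Fin k → ℝ, (∀ i, 0 ≤ c i) ∧ True ∧ ∑ i, c i • b i = x}

theorem posCone_update {n k : ℕ} (b : Fin k → Rn n) {i j : Fin k} (hij : i ≠ j) {α β : ℝ}
    (hα : 0 < α) (hβ : 0 < β) (η : Rn n →ₗ[ℝ] ℝ) (hi : η (b i) = β) (hj : η (b j) = -α)
    (hl : ∀ l, l ≠ i → l ≠ j → η (b l) = 0) :
    posCone (Function.update b j (α • b i + β • b j)) = posCone b ∩ {x | 0 ≤ η x} :=
  Set.ext fun x => edge_split_iff b hij hα hβ η hi hj hl (fun _ => True) (Or.inr fun _ => trivial) x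

theorem simplexO_update {n k : ℕ} (b : Fin k → Rn n) {i j : Fin k} (hij : i ≠ j) {α β : ℝ}
    (hα : 0 < α) (hβ : 0 < β) (hαβ : α + β = 1) (η : Rn n →ₗ[ℝ] ℝ) (hi : η (b i) = β)
    (hj : η (b j) = -α) (hl : ∀ l, l ≠ i → l ≠ j → η (b l) = 0) :
    simplexO (Function.update b j (α • b i + β • b j)) = (simplexO b).cut η := by
  refine Subtype.ext (Set.ext fun x => ?_)
  rw [PolytopeO.mem_cut, mem_simplexO, mem_simplexO]
  exact edge_split_iff b hij hα hβ η hi hj hl (fun s => s ≤ 1) (Or.inl hαβ) x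

theorem exists_functional {n k : ℕ} {b : Fin k → Rn n} (hb : LinearIndependent ℝ b)
    (a : Fin k → ℝ) : ∃ f : Rn n →ₗ[ℝ] ℝ, ∀ i, f (b i) = a i := by
  obtain ⟨f, hf⟩ := LinearMap.exists_extend ((Module.Basis.span hb).constr ℝ a)
  refine ⟨f, fun i => ?_⟩
  have h1 := LinearMap.congr_fun hf (Module.Basis.span hb i)
  rw [Module.Basis.constr_basis] at h1
  rw [← h1, LinearMap.comp_apply, Submodule.subtype_apply, Module.Basis.span_apply]

theorem exists_edge_functional {n k : ℕ} {b : Fin k → Rn n} (hb : LinearIndependent ℝ b)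
    {i j : Fin k} (hij : i ≠ j) (α β : ℝ) : ∃ η : Rn n →ₗ[ℝ] ℝ, η (b i) = β ∧ η (b j) = -α ∧
      ∀ l, l ≠ i → l ≠ j → η (b l) = 0 := by
  obtain ⟨η, h⟩ := exists_functional hb (Pi.single i β + Pi.single j (-α))
  refine ⟨η, ?_, ?_, fun l h1 h2 => ?_⟩
  · rw [h]; simp [hij]
  · rw [h]; simp [hij.symm]
  · rw [h]; simp [h1, h2]

/-! ### Functionals that are additive under cuts through the origin -/

/-- Additivity under dissections by hyperplanes through the origin. -/
def IsCutAdditive {n : ℕ} (Ψ : PolytopeO n → ℝ) : Prop :=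
  ∀ (P : PolytopeO n) (l : Rn n →ₗ[ℝ] ℝ), l ≠ 0 →
    Ψ P + Ψ ((P.cut l).cut (-l)) = Ψ (P.cut l) + Ψ (P.cut (-l))

/-- `Ψ` vanishes on all polytopes of dimension less than `k`. -/
def VanishesBelow {n : ℕ} (k : ℕ) (Ψ : PolytopeO n → ℝ) : Prop :=
  ∀ P : PolytopeO n, Module.finrank ℝ (Submodule.span ℝ P.1) < k → Ψ P = 0

theorem finrank_span_lt_of_subset_ker {n k : ℕ} {s : Set (Rn n)} {S : Submodule ℝ (Rn n)}
    (hS : Module.finrank ℝ S ≤ k) (hs : s ⊆ S) (l : Rn n →ₗ[ℝ] ℝ) (hl : ∃ y ∈ S, l y ≠ 0)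
    (h0 : ∀ x ∈ s, l x = 0) : Module.finrank ℝ (Submodule.span ℝ s) < k := by
  refine lt_of_lt_of_le (Submodule.finrank_lt_finrank_of_lt
    (lt_of_le_of_ne (Submodule.span_le.2 hs) ?_)) hS
  rintro rfl
  obtain ⟨y, hy, hly⟩ := hl
  have : Submodule.span ℝ s ≤ LinearMap.ker l := Submodule.span_le.2 fun x hx => h0 x hx
  exact hly (this hy)

/-- The common part of the two halves lies in `S ∩ ker l`, of dimension below `k`, so it does not
count. -/
theorem IsCutAdditive.eq_add {n k : ℕ} {Ψ : PolytopeO n → ℝ} (hΨ : IsCutAdditive Ψ)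
    (hlow : VanishesBelow k Ψ) (P : PolytopeO n) {S : Submodule ℝ (Rn n)}
    (hS : Module.finrank ℝ S ≤ k) (hP : P.1 ⊆ S) (l : Rn n →ₗ[ℝ] ℝ) (hl : ∃ y ∈ S, l y ≠ 0) :
    Ψ P = Ψ (P.cut l) + Ψ (P.cut (-l)) := by
  have hl0 : l ≠ 0 := by
    rintro rfl
    simp at hl
  have h0 : Ψ ((P.cut l).cut (-l)) = 0 := by
    refine hlow _ (finrank_span_lt_of_subset_ker hS (fun x hx => hP hx.1.1) l hl ?_)
    rintro x ⟨⟨-, h1⟩, h2⟩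
    have h1 : 0 ≤ l x := h1
    have h2 : 0 ≤ -l x := h2
    linarith
  rw [← hΨ P l hl0, h0, add_zero]

theorem finrank_span_range_le {n k : ℕ} (b : Fin k → Rn n) :
    Module.finrank ℝ (Submodule.span ℝ (Set.range b)) ≤ k := 
  (finrank_range_le_card b).trans (by simp)

/-- The cut is by a hyperplane through the origin, the other vertices and the chosen point of the
edge. -/
theorem IsCutAdditive.simplexO_split {n k : ℕ} {Ψ : PolytopeO n → ℝ} (hΨ : IsCutAdditive Ψ)
    (hlow : VanishesBelow k Ψ) {b : Fin k → Rn n} (hb : LinearIndependent ℝ b) {i j : Fin k}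
    (hij : i ≠ j) {α β : ℝ} (hα : 0 < α) (hβ : 0 < β) (hαβ : α + β = 1) :
    Ψ (simplexO b) = Ψ (simplexO (Function.update b j (α • b i + β • b j))) +
      Ψ (simplexO (Function.update b i (α • b i + β • b j))) := by
  obtain ⟨η, hi, hj, hl⟩ := exists_edge_functional hb hij α β
  have hsub : (simplexO b).1 ⊆ Submodule.span ℝ (Set.range b) := by
    intro x hx
    obtain ⟨c, -, -, rfl⟩ := mem_simplexO.1 hx
    exact Submodule.sum_mem _ fun i _ => Submodule.smul_mem _ _ (Submodule.subset_span ⟨i, rfl⟩)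
  rw [hΨ.eq_add hlow (simplexO b) (finrank_span_range_le b) hsub η
    ⟨b i, Submodule.subset_span ⟨i, rfl⟩, by rw [hi]; exact hβ.ne'⟩,
    simplexO_update b hij hα hβ hαβ η hi hj hl, add_comm (α • b i),
    simplexO_update b hij.symm hβ hα (by rw [add_comm]; exact hαβ) (-η) (by simp [hj])
      (by simp [hi]) (fun l h1 h2 => by simp [hl l h2 h1])]

/-! ### Refining simplicial cones until functionals have constant sign -/

/-- The functional `l` does not change sign on the family `b`. -/
def SignConst {n k : ℕ} (l : Rn n →ₗ[ℝ] ℝ) (b : Fin k → Rn n) : Prop :=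
  (∀ i, 0 ≤ l (b i)) ∨ ∀ i, l (b i) ≤ 0

theorem mem_posCone_self {n k : ℕ} (b : Fin k → Rn n) (i : Fin k) : b i ∈ posCone b :=
  ⟨Pi.single i 1, fun j => by by_cases h : j = i <;> simp [h], trivial, by
    rw [Finset.sum_eq_single i] <;> simp +contextual⟩

theorem apply_nonneg_of_mem_posCone {n k : ℕ} {b : Fin k → Rn n} {l : Rn n →ₗ[ℝ] ℝ}
    (h : ∀ i, 0 ≤ l (b i)) {x : Rn n} (hx : x ∈ posCone b) : 0 ≤ l x := by
  obtain ⟨c, hc, -, rfl⟩ := hx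
  rw [map_sum]
  exact Finset.sum_nonneg fun i _ => by
    rw [map_smul]; exact mul_nonneg (hc i) (h i)

theorem apply_nonpos_of_mem_posCone {n k : ℕ} {b : Fin k → Rn n} {l : Rn n →ₗ[ℝ] ℝ}
    (h : ∀ i, l (b i) ≤ 0) {x : Rn n} (hx : x ∈ posCone b) : l x ≤ 0 := by
  have := apply_nonneg_of_mem_posCone (l := -l) (fun i => by simpa using h i) hx
  simpa using this

theorem SignConst.mono {n k : ℕ} {l : Rn n →ₗ[ℝ] ℝ} {b b' : Fin k → Rn n} (h : SignConst l b)
    (hb : posCone b' ⊆ posCone b) : SignConst l b' := by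
  rcases h with h | h
  · exact Or.inl fun i => apply_nonneg_of_mem_posCone h (hb (mem_posCone_self b' i))
  · exact Or.inr fun i => apply_nonpos_of_mem_posCone h (hb (mem_posCone_self b' i))

theorem posCone_subset_span {n k : ℕ} (b : Fin k → Rn n) :
    posCone b ⊆ Submodule.span ℝ (Set.range b) := by
  rintro _ ⟨c, -, -, rfl⟩
  exact Submodule.sum_mem _ fun i _ => Submodule.smul_mem _ _ (Submodule.subset_span ⟨i, rfl⟩)

/-- An edge of the cone on which `l` changes sign is subdivided at its zero of `l`. Each half has
one generator fewer with `l ≠ 0`, so the process stops. -/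
theorem eq_zero_of_refine_one {n k : ℕ} {Ψ : PolytopeO n → ℝ} (hΨ : IsCutAdditive Ψ)
    (hlow : VanishesBelow k Ψ) (P₀ : PolytopeO n) (l : Rn n →ₗ[ℝ] ℝ) (b : Fin k → Rn n)
    (hb : LinearIndependent ℝ b)
    (H : ∀ b' : Fin k → Rn n, LinearIndependent ℝ b' → posCone b' ⊆ posCone b → SignConst l b' →
      ∀ P : PolytopeO n, P.1 = P₀.1 ∩ posCone b' → Ψ P = 0)
    (P : PolytopeO n) (hP : P.1 = P₀.1 ∩ posCone b) : Ψ P = 0 := by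
  classical
  induction hm : (Finset.univ.filter fun i => l (b i) ≠ 0).card using Nat.strong_induction_on
    generalizing b P with
  | _ m ih =>
    by_cases hs : SignConst l b
    · exact H b hb subset_rfl hs P hP
    · obtain ⟨⟨j, hj⟩, ⟨i, hi⟩⟩ : (∃ j, l (b j) < 0) ∧ ∃ i, 0 < l (b i) := by
        simpa [SignConst, not_or] using hs
      have hij : i ≠ j := by rintro rfl; linarith
      -- These weights make `l` vanish at `α • b i + β • b j`.
      set α := -l (b j) with hα
      set β := l (b i) with hβ
      have hα0 : 0 < α := by linarith
      obtain ⟨η, ηi, ηj, ηl⟩ := exists_edge_functional hb hij α β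
      have e1 := posCone_update b hij hα0 hi η ηi ηj ηl
      have e2 := posCone_update b hij.symm hi hα0 (-η) (by simp [ηj]) (by simp [ηi])
        (fun l h1 h2 => by simp [ηl l h2 h1])
      rw [add_comm] at e2
      set mid := α • b i + β • b j with hmid
      have hlm : l mid = 0 := by
        simp only [hmid, map_add, map_smul, smul_eq_mul]
        rw [← hβ, hα]; ring
      have hcard : ∀ i', l (b i') ≠ 0 → (Finset.univ.filter fun a =>
          l (Function.update b i' mid a) ≠ 0).card < m := by
        intro i' hi'
        rw [← hm]
        refine Finset.card_lt_card ⟨fun a ha => ?_, fun hsub => ?_⟩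
        · simp only [Finset.mem_filter, Finset.mem_univ, true_and] at ha ⊢
          by_cases h : a = i'
          · subst h; exact hi'
          · rwa [Function.update_of_ne h] at ha
        · have := hsub (Finset.mem_filter.2 ⟨Finset.mem_univ i', hi'⟩)
          simp [hlm] at this
      rw [hΨ.eq_add hlow P (finrank_span_range_le b)
        (by rw [hP]; exact fun x hx => posCone_subset_span b hx.2) η
        ⟨b i, Submodule.subset_span ⟨i, rfl⟩, by rw [ηi]; exact hi.ne'⟩]
      have hli2 : LinearIndependent ℝ (Function.update b i mid) := by
        have := linearIndependent_update_edge hb hij.symm (α := β) hα0.ne'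
        rwa [add_comm] at this
      have z1 := ih _ (hcard j hj.ne) (Function.update b j mid)
        (linearIndependent_update_edge hb hij hi.ne')
        (fun b' h1 h2 => H b' h1 (h2.trans (e1 ▸ Set.inter_subset_left)))
        (P.cut η) (by rw [e1, ← Set.inter_assoc, ← hP]; rfl) rfl
      have z2 := ih _ (hcard i hi.ne') (Function.update b i mid) hli2
        (fun b' h1 h2 => H b' h1 (h2.trans (e2 ▸ Set.inter_subset_left)))
        (P.cut (-η)) (by rw [e2, ← Set.inter_assoc, ← hP]; rfl) rfl
      rw [z1, z2, add_zero]

/-- Constant sign passes to subcones, so the functionals can be treated one after another. -/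
theorem eq_zero_of_refine {n k : ℕ} {Ψ : PolytopeO n → ℝ} (hΨ : IsCutAdditive Ψ)
    (hlow : VanishesBelow k Ψ) (P₀ : PolytopeO n) (L : Finset (Rn n →ₗ[ℝ] ℝ)) (b : Fin k → Rn n)
    (hb : LinearIndependent ℝ b)
    (H : ∀ b' : Fin k → Rn n, LinearIndependent ℝ b' → posCone b' ⊆ posCone b →
      (∀ l ∈ L, SignConst l b') → ∀ P : PolytopeO n, P.1 = P₀.1 ∩ posCone b' → Ψ P = 0)
    (P : PolytopeO n) (hP : P.1 = P₀.1 ∩ posCone b) : Ψ P = 0 := by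
  classical
  induction L using Finset.induction_on generalizing b P with
  | empty => exact H b hb subset_rfl (by simp) P hP
  | insert l L _ ih =>
    refine eq_zero_of_refine_one hΨ hlow P₀ l b hb (fun b' h1 h2 h3 => ?_) P hP
    refine ih b' h1 fun b'' k1 k2 k3 => H b'' k1 (k2.trans h2) fun f hf => ?_
    rcases Finset.mem_insert.1 hf with rfl | hf
    · exact h3.mono k2
    · exact k3 f hf

theorem PolytopeO.exists_smul_notMem {n : ℕ} (P : PolytopeO n) {v : Rn n} (hv : v ≠ 0) :
    ∃ t : ℝ, 0 ≤ t ∧ t • v ∉ P.1 := by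
  obtain ⟨C, hC⟩ := P.isCompact.isBounded.exists_norm_le
  have hv' : 0 < ‖v‖ := norm_pos_iff.2 hv
  refine ⟨(|C| + 1) / ‖v‖, by positivity, fun h => ?_⟩
  have := hC _ h
  rw [norm_smul, Real.norm_of_nonneg (by positivity), div_mul_cancel₀ _ hv'.ne'] at this
  linarith [le_abs_self C]

/-- Refine until every facet functional of `P`, and every difference comparing two normalized ones,
has constant sign. On each subcone one inequality then implies all others, and it cuts off a
simplex, unless an inequality through the origin makes the piece degenerate. -/
theorem eq_zero_of_subset_posCone {n k : ℕ} (hk : 0 < k) {Ψ : PolytopeO n → ℝ}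
    (hΨ : IsCutAdditive Ψ) (hlow : VanishesBelow k Ψ)
    (hs : ∀ b : Fin k → Rn n, LinearIndependent ℝ b → Ψ (simplexO b) = 0)
    (P : PolytopeO n) (b : Fin k → Rn n) (hb : LinearIndependent ℝ b) (hP : P.1 ⊆ posCone b) :
    Ψ P = 0 := by
  classical
  obtain ⟨W, hW0, hW⟩ := P.exists_halfspaces
  refine eq_zero_of_refine hΨ hlow P (W.image Prod.fst ∪
    (W ×ˢ W).image fun q => q.1.2 • q.2.1 - q.2.2 • q.1.1) b hb ?_ P
    (Set.inter_eq_left.2 hP).symm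
  intro b hb _ hsign Q hQ
  have hsign1 : ∀ w ∈ W, SignConst w.1 b := fun w hw =>
    hsign _ (Finset.mem_union_left _ (Finset.mem_image_of_mem _ hw))
  have hsign2 : ∀ w ∈ W, ∀ w' ∈ W, SignConst (w.2 • w'.1 - w'.2 • w.1) b := fun w hw w' hw' =>
    hsign _ (Finset.mem_union_right _ (Finset.mem_image.2
      ⟨(w, w'), Finset.mem_product.2 ⟨hw, hw'⟩, rfl⟩))
  have hQs : Q.1 ⊆ Submodule.span ℝ (Set.range b) := by
    rw [hQ]; exact fun x hx => posCone_subset_span b hx.2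
  -- Here `w ≤ 0` on the piece and `w ≥ 0` on the cone, so the piece lies in `ker w`.
  by_cases hdeg : ∃ w ∈ W, w.2 = 0 ∧ (∀ i, 0 ≤ w.1 (b i)) ∧ ∃ i, w.1 (b i) ≠ 0
  · obtain ⟨w, hw, hw2, hw3, i, hi⟩ := hdeg
    refine hlow Q (finrank_span_lt_of_subset_ker (finrank_span_range_le b) hQs w.1
      ⟨b i, Submodule.subset_span ⟨i, rfl⟩, hi⟩ fun x hx => ?_)
    rw [hQ] at hx
    have h1 := (hW x).1 hx.1 w hw
    have h2 := apply_nonneg_of_mem_posCone hw3 hx.2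
    linarith
  · have hz : ∀ w ∈ W, w.2 = 0 → ∀ i, w.1 (b i) ≤ 0 := by
      intro w hw hw2
      rcases hsign1 w hw with h | h
      · intro i
        by_contra hi
        exact hdeg ⟨w, hw, hw2, h, i, fun h0 => hi h0.le⟩
      · exact h
    -- By compactness each generating ray leaves `P`, hence violates some inequality.
    have hpos : ∀ i, ∃ w ∈ W, 0 < w.2 ∧ 0 < w.1 (b i) := by
      intro i
      by_contra! hcon
      obtain ⟨t, ht, htP⟩ := P.exists_smul_notMem (hb.ne_zero i)
      refine htP ((hW _).2 fun w hw => ?_)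
      rw [map_smul, smul_eq_mul]
      have : w.1 (b i) ≤ 0 := by
        rcases eq_or_lt_of_le (hW0 w hw) with h | h
        · exact hz w hw h.symm i
        · exact hcon w hw h
      exact (mul_nonpos_of_nonneg_of_nonpos ht this).trans (hW0 w hw)
    obtain ⟨w₀, hw₀, hw₀p, -⟩ := hpos ⟨0, hk⟩
    -- Since the differences have constant sign on the generators, comparing sums over the
    -- generators compares the functionals at each of them.
    obtain ⟨w, hw, hmax⟩ := (W.filter fun w => 0 < w.2).exists_max_image
      (fun w => (∑ i, w.1 (b i)) / w.2) ⟨w₀, Finset.mem_filter.2 ⟨hw₀, hw₀p⟩⟩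
    obtain ⟨hwW, hwp⟩ := Finset.mem_filter.1 hw
    have hdom : ∀ w' ∈ W, 0 < w'.2 → ∀ i, w.2 * w'.1 (b i) ≤ w'.2 * w.1 (b i) := by
      intro w' hw' hw'p
      have hsum : 0 ≤ ∑ i, (w'.2 • w.1 - w.2 • w'.1) (b i) := by
        have := hmax w' (Finset.mem_filter.2 ⟨hw', hw'p⟩)
        rw [div_le_div_iff₀ hw'p hwp] at this
        simp only [LinearMap.sub_apply, LinearMap.smul_apply, smul_eq_mul, Finset.sum_sub_distrib,
          ← Finset.mul_sum]
        linarith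
      rcases hsign2 w' hw' w hwW with h | h
      · intro i
        have := h i
        simp only [LinearMap.sub_apply, LinearMap.smul_apply, smul_eq_mul] at this
        linarith
      · have h0 := (Finset.sum_eq_zero_iff_of_nonpos fun i _ => h i).1
          (le_antisymm (Finset.sum_nonpos fun i _ => h i) hsum)
        intro i
        have := h0 i (Finset.mem_univ i)
        simp only [LinearMap.sub_apply, LinearMap.smul_apply, smul_eq_mul] at this
        linarith
    have hwb : ∀ i, 0 < w.1 (b i) := by
      intro i
      obtain ⟨w', hw', hp', hpb'⟩ := hpos i
      have := hdom w' hw' hp' i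
      have h2 := mul_pos hwp hpb'
      exact pos_of_mul_pos_right (h2.trans_le this) hp'.le
    have hQw : ∀ x, x ∈ Q.1 ↔ x ∈ posCone b ∧ w.1 x ≤ w.2 := by
      intro x
      rw [hQ, Set.mem_inter_iff, hW]
      constructor
      · rintro ⟨h1, h2⟩
        exact ⟨h2, h1 w hwW⟩
      · rintro ⟨h2, h1⟩
        refine ⟨fun w' hw' => ?_, h2⟩
        rcases eq_or_lt_of_le (hW0 w' hw') with h | h
        · rw [← h]
          exact apply_nonpos_of_mem_posCone (hz w' hw' h.symm) h2
        · have h3 := apply_nonneg_of_mem_posCone (l := w'.2 • w.1 - w.2 • w'.1) (b := b)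
            (fun i => by
              have := hdom w' hw' h i
              simp only [LinearMap.sub_apply, LinearMap.smul_apply, smul_eq_mul]
              linarith) h2
          simp only [LinearMap.sub_apply, LinearMap.smul_apply, smul_eq_mul] at h3
          have h4 := mul_le_mul_of_nonneg_left h1 h.le
          have h5 : w.2 * w'.1 x ≤ w.2 * w'.2 := by linarith
          exact le_of_mul_le_mul_left h5 hwp
    -- The vertices are the points where the rays meet the dominating hyperplane.
    have hQe : Q = simplexO fun i => (w.2 / w.1 (b i)) • b i := by
      refine Subtype.ext (Set.ext fun x => ?_)
      rw [hQw, mem_simplexO]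
      constructor
      · rintro ⟨⟨c, hc, -, rfl⟩, hx⟩
        refine ⟨fun i => c i * (w.1 (b i) / w.2), fun i =>
          mul_nonneg (hc i) (div_nonneg (hwb i).le hwp.le), ?_, ?_⟩
        · rw [map_sum] at hx
          simp only [map_smul, smul_eq_mul] at hx
          simp only [mul_div_assoc', ← Finset.sum_div]
          rwa [div_le_one hwp]
        · refine Finset.sum_congr rfl fun i _ => ?_
          rw [smul_smul]
          congr 1
          have := hwb i
          field_simp
      · rintro ⟨c, hc, hc1, rfl⟩
        constructor
        · refine ⟨fun i => c i * (w.2 / w.1 (b i)), fun i =>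
            mul_nonneg (hc i) (div_nonneg hwp.le (hwb i).le), trivial, ?_⟩
          simp only [smul_smul]
        · rw [map_sum]
          simp only [map_smul, smul_eq_mul]
          have : ∑ i, c i * (w.2 / w.1 (b i) * w.1 (b i)) = (∑ i, c i) * w.2 := by
            rw [Finset.sum_mul]
            refine Finset.sum_congr rfl fun i _ => ?_
            rw [div_mul_cancel₀ _ (hwb i).ne']
          rw [this]
          nlinarith
    rw [hQe]
    refine hs _ ?_
    exact hb.units_smul fun i => Units.mk0 (w.2 / w.1 (b i)) (div_pos hwp (hwb i)).ne'

/-- Cutting along the coordinate hyperplanes of the basis `b` leaves pieces in orthants, which are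
simplicial cones. The set `s` holds the coordinates whose sign is not yet fixed. -/
theorem eq_zero_of_subset_span {n k : ℕ} (hk : 0 < k) {Ψ : PolytopeO n → ℝ}
    (hΨ : IsCutAdditive Ψ) (hlow : VanishesBelow k Ψ)
    (hs : ∀ b : Fin k → Rn n, LinearIndependent ℝ b → Ψ (simplexO b) = 0)
    {b : Fin k → Rn n} (hb : LinearIndependent ℝ b) (f : Fin k → Rn n →ₗ[ℝ] ℝ)
    (hf : ∀ i j, f i (b j) = if j = i then 1 else 0) (s : Finset (Fin k)) (Q : PolytopeO n)
    (hQ : Q.1 ⊆ Submodule.span ℝ (Set.range b))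
    (hsg : ∀ i ∉ s, (∀ x ∈ Q.1, 0 ≤ f i x) ∨ ∀ x ∈ Q.1, f i x ≤ 0) : Ψ Q = 0 := by
  classical
  induction s using Finset.induction_on generalizing Q with
  | empty =>
    have hε : ∀ i, ∃ ε : ℝ, ε * ε = 1 ∧ ∀ x ∈ Q.1, 0 ≤ ε * f i x := by
      intro i
      rcases hsg i (by simp) with h | h
      · exact ⟨1, by simp, fun x hx => by simpa using h x hx⟩
      · exact ⟨-1, by simp, fun x hx => by simpa using h x hx⟩
    choose ε hε1 hε using hε
    have hε0 : ∀ i, ε i ≠ 0 := fun i h => by simpa [h] using hε1 i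
    refine eq_zero_of_subset_posCone hk hΨ hlow hs Q (fun i => ε i • b i)
      (hb.units_smul fun i => Units.mk0 (ε i) (hε0 i)) ?_
    intro x hx
    obtain ⟨c, rfl⟩ := (Submodule.mem_span_range_iff_exists_fun ℝ).1 (hQ hx)
    have hfc : ∀ i, f i (∑ j, c j • b j) = c i := by
      intro i
      rw [map_sum]
      simp only [map_smul, hf, smul_eq_mul]
      simp
    refine ⟨fun i => ε i * c i, fun i => ?_, trivial, Finset.sum_congr rfl fun i _ => ?_⟩
    · have := hε i _ hx
      rwa [hfc] at this
    · rw [smul_smul, mul_right_comm, hε1, one_mul]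
  | insert i s _ ih =>
    rw [hΨ.eq_add hlow Q (finrank_span_range_le b) hQ (f i)
      ⟨b i, Submodule.subset_span ⟨i, rfl⟩, by rw [hf]; simp⟩,
      ih (Q.cut (f i)) (fun x hx => hQ hx.1) fun j hj => ?_,
      ih (Q.cut (-f i)) (fun x hx => hQ hx.1) fun j hj => ?_, add_zero]
    · by_cases hji : j = i
      · subst hji
        exact Or.inr fun x hx => by
          have h : 0 ≤ -f j x := hx.2
          linarith
      · exact (hsg j (by simp [hji, hj])).imp (fun h x hx => h x hx.1) fun h x hx => h x hx.1
    · by_cases hji : j = i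
      · subst hji
        exact Or.inl fun x hx => hx.2
      · exact (hsg j (by simp [hji, hj])).imp (fun h x hx => h x hx.1) fun h x hx => h x hx.1

theorem exists_linearIndependent_span_eq {E : Type*} [AddCommGroup E] [Module ℝ E]
    [FiniteDimensional ℝ E] {S : Submodule ℝ E} {k : ℕ} (hS : Module.finrank ℝ S = k) :
    ∃ b : Fin k → E, LinearIndependent ℝ b ∧ Submodule.span ℝ (Set.range b) = S := by
  let B := Module.finBasisOfFinrankEq ℝ S hS
  refine ⟨S.subtype ∘ B, B.linearIndependent.map' _ (Submodule.ker_subtype _), ?_⟩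
  rw [Set.range_comp, Submodule.span_image, B.span_eq, Submodule.map_top, Submodule.range_subtype]

/-- A cut-additive functional that vanishes on polytopes of dimension less than `k` and on
`k`-dimensional simplices with a vertex at the origin vanishes on polytopes of dimension `k`. -/
theorem IsCutAdditive.eq_zero {n k : ℕ} (hk : 0 < k) {Ψ : PolytopeO n → ℝ}
    (hΨ : IsCutAdditive Ψ) (hlow : VanishesBelow k Ψ)
    (hs : ∀ b : Fin k → Rn n, LinearIndependent ℝ b → Ψ (simplexO b) = 0) :
    VanishesBelow (k + 1) Ψ := by
  classical
  intro P hP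
  rcases Nat.lt_succ_iff_lt_or_eq.1 hP with hP | hP
  · exact hlow P hP
  obtain ⟨b, hb, hspan⟩ := exists_linearIndependent_span_eq hP
  choose f hf using fun i : Fin k => exists_functional hb fun j => if j = i then 1 else 0
  exact eq_zero_of_subset_span hk hΨ hlow hs hb f hf Finset.univ P
    (fun x hx => by rw [hspan]; exact Submodule.subset_span hx) (by simp)

/-! ### Vanishing of contravariant valuations on lower-dimensional polytopes -/

theorem IsValuation.isCutAdditive {n : ℕ} {p : ℝ} {Φ : PolytopeO n → Cp n p}
    (hval : IsValuation Φ) (u : Rn n) : IsCutAdditive fun P => (Φ P).1 u := by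
  intro P l _
  have h := hval (P.cut l) (P.cut (-l)) P ((P.cut l).cut (-l)) ?_ ?_
  · simpa using congrArg (fun f : Cp n p => f.1 u) h
  · ext x
    have : (-l) x = -l x := rfl
    simp only [Set.mem_union, PolytopeO.mem_cut, this]
    constructor
    · intro hx
      rcases le_total 0 (l x) with h | h
      · exact Or.inl ⟨hx, h⟩
      · exact Or.inr ⟨hx, by linarith⟩
    · rintro (h | h) <;> exact h.1
  · ext x
    simp only [Set.mem_inter_iff, PolytopeO.mem_cut]
    tauto

theorem IsSLContravariant.apply_map {n : ℕ} {p : ℝ} {Φ : PolytopeO n → Cp n p}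
    (hΦ : IsSLContravariant Φ) {L : Rn n →ₗ[ℝ] Rn n} (hL : LinearMap.det L = 1) (P : PolytopeO n)
    (x : Rn n) : (Φ (P.map L)).1 (L x) = (Φ P).1 x := by
  let A : Matrix (Fin n) (Fin n) ℝ := Matrix.toEuclideanLin.symm L
  have hAL : Matrix.toEuclideanLin A = L := LinearEquiv.apply_symm_apply _ _
  have hA : A.det = 1 := by
    rw [← hL, ← hAL, Matrix.toEuclideanLin, Matrix.toLpLin_eq_toLin, LinearMap.det_toLin]
  have h := hΦ ⟨A, hA⟩ P (L x)
  change (Φ (P.map (Matrix.toEuclideanLin A))).1 (L x) = _ at h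
  rw [hAL] at h
  rw [h]
  congr 1
  change Matrix.toEuclideanLin (Matrix.adjugate A) (L x) = x
  rw [← hAL, ← LinearMap.comp_apply]
  ext i
  simp [Matrix.toLpLin_apply, Matrix.adjugate_mul, hA]

theorem Cp_apply_smul {n : ℕ} {p : ℝ} (f : Cp n p) {s : ℝ} (hs : 0 < s) (x : Rn n) :
    f.1 (s • x) = s ^ p * f.1 x := f.2 s hs x

theorem dense_apply_ne_zero {n : ℕ} {w : Rn n →ₗ[ℝ] ℝ} (hw : w ≠ 0) : Dense {x | w x ≠ 0} := by
  have : {x | w x ≠ 0} = ((LinearMap.ker w : Submodule ℝ (Rn n)) : Set (Rn n))ᶜ := by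
    ext x; simp
  rw [this, ← interior_eq_empty_iff_dense_compl, ← Set.not_nonempty_iff_eq_empty]
  intro h
  exact hw (LinearMap.ker_eq_top.1 (Submodule.eq_top_of_nonempty_interior' _ h))

theorem isOpen_apply_ne_zero {n : ℕ} (w : Rn n →ₗ[ℝ] ℝ) : IsOpen {x | w x ≠ 0} :=
  isOpen_ne_fun (LinearMap.continuous_of_finiteDimensional w) continuous_const

/-- A transvection along `w` in a direction of `ker w` fixes `P` pointwise and can carry `x` to `y`.
-/
theorem IsSLContravariant.apply_eq_apply {n : ℕ} {p : ℝ} {Φ : PolytopeO n → Cp n p}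
    (hΦ : IsSLContravariant Φ) {P : PolytopeO n} {w : Rn n →ₗ[ℝ] ℝ} (hP : ∀ x ∈ P.1, w x = 0)
    {x y : Rn n} (hxy : w x = w y) (hx : w x ≠ 0) : (Φ P).1 x = (Φ P).1 y := by
  have ha : w ((w x)⁻¹ • (y - x)) = 0 := by simp [hxy]
  let L := LinearMap.transvection w ((w x)⁻¹ • (y - x))
  have hL : LinearMap.det L = 1 := by rw [LinearMap.transvection.det, ha, add_zero]
  have hLx : L x = y := by
    rw [LinearMap.transvection.apply, smul_smul, mul_inv_cancel₀ hx, one_smul]; abel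
  have hLP : P.map L = P := by
    refine Subtype.ext ?_
    change L '' P.1 = P.1
    conv_rhs => rw [← Set.image_id P.1]
    refine Set.image_congr fun z hz => ?_
    rw [LinearMap.transvection.apply, hP z hz, zero_smul, add_zero]; rfl
  rw [← hΦ.apply_map hL, hLx, hLP]

/-- In codimension two, a shift along `b` changes `w'` without changing `w`. -/
theorem exists_functional_pair {n : ℕ} {S : Submodule ℝ (Rn n)}
    (hS : Module.finrank ℝ S + 2 ≤ n) : ∃ (w w' : Rn n →ₗ[ℝ] ℝ) (b : Rn n),
      (∀ x ∈ S, w x = 0) ∧ (∀ x ∈ S, w' x = 0) ∧ w ≠ 0 ∧ w b = 0 ∧ w' b = 1 := by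
  have key : ∀ S' : Submodule ℝ (Rn n), Module.finrank ℝ S' < n →
      ∃ w : Rn n →ₗ[ℝ] ℝ, w ≠ 0 ∧ ∀ x ∈ S', w x = 0 := by
    intro S' h
    obtain ⟨w, hw, hS'⟩ := Submodule.exists_le_ker_of_lt_top S' (lt_top_iff_ne_top.2 (by
      rintro rfl
      rw [finrank_top, finrank_euclideanSpace_fin] at h
      exact h.false))
    exact ⟨w, hw, fun x hx => hS' hx⟩
  obtain ⟨w', hw', hS'⟩ := key S (by omega)
  obtain ⟨b₀, hb₀⟩ := DFunLike.ne_iff.1 hw'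
  let b := (w' b₀)⁻¹ • b₀
  have hb : w' b = 1 := by
    have : w' b₀ ≠ 0 := hb₀
    simp [b, this]
  obtain ⟨w, hw, hSw⟩ := key (S ⊔ Submodule.span ℝ {b}) (by
    have := Submodule.finrank_add_le_finrank_add_finrank S (Submodule.span ℝ {b})
    have h2 := finrank_span_le_card (R := ℝ) ({b} : Set (Rn n))
    simp at h2
    omega)
  exact ⟨w, w', b, fun x hx => hSw x (Submodule.mem_sup_left hx), hS', hw,
    hSw b (Submodule.mem_sup_right (Submodule.mem_span_singleton_self b)), hb⟩

/-- Homogeneity gives the factor `2 ^ p > 2 ≥ c`. The cases used are `c = 1` (codimension at least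
two) and `c = 2` (codimension one). -/
theorem eq_zero_of_apply_two_smul {n : ℕ} {p : ℝ} (hp : 1 < p) (f : Cp n p) {x : Rn n} {c : ℝ}
    (hc : c ≤ 2) (h : f.1 ((2 : ℝ) • x) = c * f.1 x) : f.1 x = 0 := by
  rw [Cp_apply_smul f two_pos] at h
  have h2 : (2 : ℝ) < 2 ^ p := by
    simpa using Real.rpow_lt_rpow_of_exponent_lt (by norm_num : (1 : ℝ) < 2) hp
  have : (2 ^ p - c) * f.1 x = 0 := by linarith
  exact (mul_eq_zero.1 this).resolve_left (by linarith)

theorem IsSLContravariant.vanishesBelow {n : ℕ} {p : ℝ} (hp : 1 < p) {Φ : PolytopeO n → Cp n p}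
    (hΦ : IsSLContravariant Φ) (u : Rn n) : VanishesBelow (n - 1) fun P => (Φ P).1 u := by
  intro P hP
  obtain ⟨w, w', b, hw, hw', hw0, hwb, hwb'⟩ := exists_functional_pair (by omega :
    Module.finrank ℝ (Submodule.span ℝ P.1) + 2 ≤ n)
  have hw'0 : w' ≠ 0 := by rintro rfl; simp at hwb'
  have hdense := (dense_apply_ne_zero hw0).inter_of_isOpen_right (dense_apply_ne_zero hw'0)
    (isOpen_apply_ne_zero w')
  have := Continuous.ext_on hdense (Φ P).1.continuous continuous_zero ?_
  · exact congrFun this u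
  rintro x ⟨hx, hx'⟩
  have hx : w x ≠ 0 := hx
  have hx' : w' x ≠ 0 := hx'
  refine eq_zero_of_apply_two_smul hp (Φ P) one_le_two ?_
  -- The point `x` moves to `2x` in two steps: the first keeps `w` and doubles `w'`, the second
  -- keeps `w'`.
  rw [one_mul, hΦ.apply_eq_apply (fun z hz => hw z (Submodule.subset_span hz))
    (x := x) (y := x + w' x • b) (by simp [hwb]) hx,
    hΦ.apply_eq_apply (fun z hz => hw' z (Submodule.subset_span hz))
    (x := x + w' x • b) (y := (2 : ℝ) • x) (by simp [hwb']; ring) (by simp [hwb', hx'])]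

/-- A map of determinant `1/2` carries the simplex to its half; composed with a stretch by `2`
transverse to `ker w` it lies in `SL(n)`. The stretch doubles `w`, and off `ker w` only the value of
`w` matters. -/
theorem IsSLContravariant.apply_simplexO_midpoint {n k : ℕ} {p : ℝ} {Φ : PolytopeO n → Cp n p}
    (hΦ : IsSLContravariant Φ) {b : Fin k → Rn n} (hb : LinearIndependent ℝ b)
    {w : Rn n →ₗ[ℝ] ℝ} (hw : w ≠ 0) (hwb : ∀ i, w (b i) = 0) {i j : Fin k} (hij : i ≠ j)
    {x : Rn n} (hx : w x ≠ 0) :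
    (Φ (simplexO (Function.update b j ((1 / 2 : ℝ) • b i + (1 / 2 : ℝ) • b j)))).1 ((2 : ℝ) • x)
      = (Φ (simplexO b)).1 x := by
  obtain ⟨z₀, hz₀⟩ := DFunLike.ne_iff.1 hw
  have hz₀ : w z₀ ≠ 0 := hz₀
  let z := (w z₀)⁻¹ • z₀
  have hz : w z = 1 := by simp [z, hz₀]
  obtain ⟨f, hf⟩ := exists_functional hb (Pi.single j 1)
  let L := LinearMap.transvection w z ∘ₗ LinearMap.transvection f ((1 / 2 : ℝ) • (b i - b j))
  have hL : LinearMap.det L = 1 := by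
    rw [LinearMap.det_comp, LinearMap.transvection.det, LinearMap.transvection.det, hz]
    simp [hf, hij]
    norm_num
  have hLb : (fun l => L (b l)) =
      Function.update b j ((1 / 2 : ℝ) • b i + (1 / 2 : ℝ) • b j) := by
    funext l
    simp only [L, LinearMap.comp_apply, LinearMap.transvection.apply, map_add, map_smul, map_sub,
      hwb, hf]
    by_cases h : l = j
    · subst h; simp; module
    · simp [h]
  have hLx : w (L x) = w ((2 : ℝ) • x) := by
    simp only [L, LinearMap.comp_apply, LinearMap.transvection.apply, map_add, map_smul, map_sub,
      hwb, hz]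
    simp; ring
  rw [← hΦ.apply_map hL (simplexO b) x, PolytopeO.map_simplexO, hLb]
  refine hΦ.apply_eq_apply (w := w) (fun y hy => ?_) hLx.symm (by simpa using hx)
  obtain ⟨c, -, -, rfl⟩ := mem_simplexO.1 hy
  rw [map_sum]
  refine Finset.sum_eq_zero fun l _ => ?_
  rw [map_smul]
  by_cases h : l = j
  · subst h; simp [hwb]
  · simp [h, hwb]

/-- Both halves of a bisected `(n - 1)`-simplex take at `2x` the value of the whole at `x`. An edge
to bisect, away from the origin, requires `n - 1 ≥ 2`. -/
theorem vanishesBelow_dim {n : ℕ} (hn : 3 ≤ n) {p : ℝ} (hp : 1 < p) {Φ : PolytopeO n → Cp n p}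
    (hval : IsValuation Φ) (hΦ : IsSLContravariant Φ) (u : Rn n) :
    VanishesBelow n fun P => (Φ P).1 u := by
  obtain ⟨k, rfl⟩ : ∃ k, n = k + 1 := ⟨n - 1, by omega⟩
  refine (hval.isCutAdditive u).eq_zero (by omega) (hΦ.vanishesBelow hp u) fun b hb => ?_
  obtain ⟨w, hw, hwS⟩ := Submodule.exists_le_ker_of_lt_top (Submodule.span ℝ (Set.range b))
    (lt_top_iff_ne_top.2 (by
      intro h
      have := finrank_span_range_le b
      rw [h, finrank_top, finrank_euclideanSpace_fin] at this
      omega))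
  have hwb : ∀ i, w (b i) = 0 := fun i => hwS (Submodule.subset_span ⟨i, rfl⟩)
  refine congrFun (Continuous.ext_on (dense_apply_ne_zero hw) (Φ (simplexO b)).1.continuous
    continuous_zero fun x hx => ?_) u
  have hx : w x ≠ 0 := hx
  refine eq_zero_of_apply_two_smul hp (Φ (simplexO b)) le_rfl ?_
  let i : Fin k := ⟨0, by omega⟩
  let j : Fin k := ⟨1, by omega⟩
  have hij : i ≠ j := by simp [i, j]
  have h := (hval.isCutAdditive ((2 : ℝ) • x)).simplexO_split (hΦ.vanishesBelow hp _) hb hij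
    (one_half_pos (α := ℝ)) one_half_pos (by norm_num)
  rw [h, hΦ.apply_simplexO_midpoint hb hw hwb hij hx, add_comm ((1 / 2 : ℝ) • b i),
    hΦ.apply_simplexO_midpoint hb hw hwb hij.symm hx]
  ring

/-! ### The values on simplices -/

/-- The standard basis vector `eᵢ`. -/
abbrev stdVec {n : ℕ} (i : Fin n) : Rn n := EuclideanSpace.single i (1 : ℝ)

/-- The `i`-th coordinate functional. -/
def coordFn {n : ℕ} (i : Fin n) : Rn n →ₗ[ℝ] ℝ := (EuclideanSpace.proj i : Rn n →L[ℝ] ℝ)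

@[simp] theorem coordFn_apply {n : ℕ} (i : Fin n) (x : Rn n) : coordFn i x = x i := rfl

theorem stdSimplexO_eq {n : ℕ} : stdSimplexO n = simplexO stdVec := rfl

theorem sum_smul_stdVec {n : ℕ} (x : Rn n) : ∑ i, x i • stdVec i = x := by
  ext j
  simp [Pi.single_apply]

theorem linearIndependent_stdVec {n : ℕ} : LinearIndependent ℝ (stdVec : Fin n → Rn n) := by
  have := (EuclideanSpace.basisFun (Fin n) ℝ).toBasis.linearIndependent
  have h : (stdVec : Fin n → Rn n) = (EuclideanSpace.basisFun (Fin n) ℝ).toBasis := by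
    ext i
    simp
  rw [h]
  exact this

/-- The dilation factor turning the standard simplex into one of volume `t / n!`. -/
def dil (n : ℕ) (t : ℝ) : ℝ := t ^ (1 / n : ℝ)

theorem dil_pos {n : ℕ} {t : ℝ} (ht : 0 < t) : 0 < dil n t := Real.rpow_pos_of_pos ht _

theorem dil_pow {n : ℕ} (hn : n ≠ 0) {t : ℝ} (ht : 0 < t) : dil n t ^ n = t := by
  rw [dil, one_div, Real.rpow_inv_natCast_pow ht.le hn]

theorem det_smul_Rn {n : ℕ} (c : ℝ) (A : Rn n →ₗ[ℝ] Rn n) :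
    LinearMap.det (c • A) = c ^ n * LinearMap.det A := by
  rw [LinearMap.det_smul, finrank_euclideanSpace_fin]

/-- `profile Φ t x` is the value at `A x` of `Φ (A Tⁿ)` for any `A` of determinant `t > 0`. -/
def profile {n : ℕ} {p : ℝ} (Φ : PolytopeO n → Cp n p) (t : ℝ) (x : Rn n) : ℝ :=
  (Φ ((stdSimplexO n).scale (dil n t))).1 (dil n t • x)

theorem PolytopeO.scale_stdSimplexO {n : ℕ} (s : ℝ) :
    (stdSimplexO n).scale s = simplexO fun i => s • stdVec i := by
  rw [PolytopeO.scale, stdSimplexO_eq, PolytopeO.map_simplexO]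
  rfl

/-- `A` is a dilation followed by an element of `SL(n)`, so only its determinant matters. -/
theorem IsSLContravariant.apply_map_stdSimplexO {n : ℕ} (hn : n ≠ 0) {p : ℝ}
    {Φ : PolytopeO n → Cp n p} (hΦ : IsSLContravariant Φ) {A : Rn n →ₗ[ℝ] Rn n}
    (hA : 0 < LinearMap.det A) (x : Rn n) :
    (Φ ((stdSimplexO n).map A)).1 (A x) = profile Φ (LinearMap.det A) x := by
  set s := dil n (LinearMap.det A) with hs
  have hs0 : 0 < s := dil_pos hA
  have hL : LinearMap.det (s⁻¹ • A) = 1 := by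
    rw [det_smul_Rn, inv_pow, hs, dil_pow hn hA, inv_mul_cancel₀ hA.ne']
  rw [profile, ← hs, PolytopeO.scale_stdSimplexO,
    ← hΦ.apply_map hL (simplexO fun i => s • stdVec i) (s • x), stdSimplexO_eq,
    PolytopeO.map_simplexO, PolytopeO.map_simplexO]
  simp [smul_smul, mul_inv_cancel₀ hs0.ne']

/-- The properties of the profile of an `SL(n)`-contravariant valuation. -/
structure IsProfile {n : ℕ} (p : ℝ) (F : ℝ → Rn n → ℝ) : Prop where
  cont : ∀ t, Continuous (F t)
  hom : ∀ (t s : ℝ) (x : Rn n), 0 < s → F t (s • x) = s ^ p * F t x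
  split : ∀ i j : Fin n, i ≠ j → ∀ r s : ℝ, 0 < r → 0 < s → ∀ x : Rn n,
    F (r + s) x = F r (x + (x j * (s / r)) • (stdVec j - stdVec i)) +
      F s (x + (x i * (r / s)) • (stdVec i - stdVec j))
  symm : ∀ (t c : ℝ) (i j : Fin n), F t (c • stdVec i) = F t (c • stdVec j)

/-- The part of the split simplex is the image of `Tⁿ` under a dilated transvection of determinant
`r`; the argument of `profile` is the preimage of `dil n (r + s) • x` under it. -/
theorem IsSLContravariant.apply_simplexO_update {n : ℕ} (hn : n ≠ 0) {p : ℝ}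
    {Φ : PolytopeO n → Cp n p} (hΦ : IsSLContravariant Φ) {i j : Fin n} (hij : i ≠ j)
    {r s : ℝ} (hr : 0 < r) (hs : 0 < s) (x : Rn n) :
    (Φ (simplexO (Function.update (fun l => dil n (r + s) • stdVec l) j
      ((s / (r + s)) • (dil n (r + s) • stdVec i) + (r / (r + s)) • (dil n (r + s) • stdVec j))))).1
      (dil n (r + s) • x) = profile Φ r (x + (x j * (s / r)) • (stdVec j - stdVec i)) := by
  have hrs : 0 < r + s := by positivity
  set d := dil n (r + s) with hd
  let A := d • LinearMap.transvection (coordFn j) ((s / (r + s)) • (stdVec i - stdVec j))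
  have hdet : LinearMap.det A = r := by
    rw [det_smul_Rn, LinearMap.transvection.det, hd, dil_pow hn hrs]
    simp [hij.symm]
    field_simp
    ring
  have hA : (fun l => A (stdVec l)) = Function.update (fun l => d • stdVec l) j
      ((s / (r + s)) • (d • stdVec i) + (r / (r + s)) • (d • stdVec j)) := by
    funext l
    simp only [A, LinearMap.smul_apply, LinearMap.transvection.apply, coordFn_apply]
    by_cases h : l = j
    · subst h
      have : r / (r + s) = 1 - s / (r + s) := by field_simp; ring
      rw [Function.update_self, this]
      simp
      module
    · simp [h, Ne.symm h]
  have hAx : A (x + (x j * (s / r)) • (stdVec j - stdVec i)) = d • x := by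
    simp only [A, LinearMap.smul_apply, LinearMap.transvection.apply, coordFn_apply]
    congr 1
    have h1 : (x + (x j * (s / r)) • (stdVec j - stdVec i)) j * (s / (r + s)) = x j * (s / r) := by
      simp [hij.symm]
      field_simp
    rw [smul_smul, h1]
    module
  have := hΦ.apply_map_stdSimplexO hn (A := A) (by rw [hdet]; exact hr)
    (x + (x j * (s / r)) • (stdVec j - stdVec i))
  rw [hAx, hdet, stdSimplexO_eq, PolytopeO.map_simplexO, hA] at this
  exact this

theorem simplexO_congr {n k : ℕ} {b b' : Fin k → Rn n} (h : Set.range b = Set.range b') :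
    simplexO b = simplexO b' := by
  refine Subtype.ext ?_
  change convexHull ℝ (insert 0 (Set.range b)) = convexHull ℝ (insert 0 (Set.range b'))
  rw [h]

theorem isProfile {n : ℕ} (hn : 3 ≤ n) {p : ℝ} (hp : 1 < p) {Φ : PolytopeO n → Cp n p}
    (hval : IsValuation Φ) (hΦ : IsSLContravariant Φ) : IsProfile p (profile Φ) where
  cont t := (Φ _).1.continuous.comp (continuous_const_smul _)
  hom t s x hs := by rw [profile, smul_comm, Cp_apply_smul _ hs, profile]
  split i j hij r s hr hs x := by
    have hrs : 0 < r + s := by positivity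
    have hb : LinearIndependent ℝ fun l : Fin n => dil n (r + s) • (stdVec l : Rn n) :=
      linearIndependent_stdVec.units_smul fun _ => Units.mk0 _ (dil_pos hrs).ne'
    have h := (hval.isCutAdditive (dil n (r + s) • x)).simplexO_split
      (vanishesBelow_dim hn hp hval hΦ _) hb hij (div_pos hs hrs) (div_pos hr hrs)
      (by field_simp; ring)
    have h1 := hΦ.apply_simplexO_update (by omega) hij hr hs x
    have h2 := hΦ.apply_simplexO_update (by omega) hij.symm hs hr x
    rw [add_comm s r, add_comm ((r / (r + s)) • _)] at h2
    rw [profile, PolytopeO.scale_stdSimplexO, h, h1, h2]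
  symm t c i j := by
    by_cases hij : i = j
    · rw [hij]
    obtain ⟨k, hk⟩ : ∃ k, k ∉ ({i, j} : Finset (Fin n)) := by
      by_contra! h
      have h1 := Finset.card_le_card (fun x _ => h x : (Finset.univ : Finset (Fin n)) ⊆ {i, j})
      have h2 := Finset.card_le_two (a := i) (b := j)
      rw [Finset.card_univ, Fintype.card_fin] at h1
      omega
    simp only [Finset.mem_insert, Finset.mem_singleton, not_or] at hk
    -- A transposition has determinant `-1`; the third index `k` gives an even permutation relating
    -- the two axes.
    let σ : Equiv.Perm (Fin n) := Equiv.swap i j * Equiv.swap i k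
    let A : Rn n →ₗ[ℝ] Rn n := Matrix.toEuclideanLin (σ.permMatrix ℝ)
    have hσ : σ.symm i = j := by
      rw [Equiv.symm_apply_eq]
      simp [σ, Equiv.swap_apply_of_ne_of_ne (Ne.symm hij) (Ne.symm hk.2)]
    have hdet : LinearMap.det A = 1 := by
      simp only [A, Matrix.toEuclideanLin]
      rw [Matrix.toLpLin_eq_toLin, LinearMap.det_toLin, Matrix.det_permutation]
      simp [σ, Equiv.Perm.sign_swap hij, Equiv.Perm.sign_swap (Ne.symm hk.1)]
    have hA : ∀ l, A (stdVec l) = stdVec (σ.symm l) := by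
      intro l
      ext m
      simp only [A, Matrix.toLpLin_apply, Matrix.permMatrix_mulVec]
      simp [Pi.single_apply, Equiv.eq_symm_apply]
    rw [profile, profile, ← hΦ.apply_map hdet, PolytopeO.scale_stdSimplexO,
      PolytopeO.map_simplexO]
    simp only [map_smul, hA, hσ]
    congr 3
    refine simplexO_congr ?_
    exact σ.symm.surjective.range_comp (fun l => dil n t • stdVec l)

/-! ### Additive functions with a non-dense graph -/

/-- The additive extension to `ℝ` of an additive function on the positive half-line. -/
theorem exists_addMonoidHom_extension {g : ℝ → ℝ}
    (hg : ∀ u v, 0 < u → 0 < v → g (u + v) = g u + g v) :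
    ∃ G : ℝ →+ ℝ, ∀ t, 0 < t → G t = g t := by
  have hpos : ∀ x : ℝ, 0 < |x| + 1 := fun x => by positivity
  have hpos' : ∀ x : ℝ, 0 < x + |x| + 1 := fun x => by linarith [neg_abs_le x]
  -- Each `x` is written as a difference of two positive numbers.
  refine ⟨AddMonoidHom.mk' (fun x => g (x + |x| + 1) - g (|x| + 1)) fun x y => ?_, fun t ht => ?_⟩
  · have e1 := hg _ _ (hpos' (x + y)) (add_pos (hpos x) (hpos y))
    have e2 := hg _ _ (hpos x) (hpos y)
    have e3 := hg _ _ (add_pos (hpos' x) (hpos' y)) (hpos (x + y))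
    have e4 := hg _ _ (hpos' x) (hpos' y)
    have : x + y + |x + y| + 1 + (|x| + 1 + (|y| + 1))
      = x + |x| + 1 + (y + |y| + 1) + (|x + y| + 1) := by ring
    rw [this] at e1
    linarith
  · have := hg _ _ ht (hpos t)
    rw [← add_assoc] at this
    simp [this]

/-- If `g` is not linear, `(1, g 1)` and `(t₀, g t₀)` are linearly independent, so their rational
span is dense in the plane. -/
theorem mem_closure_graph_of_additive {g : ℝ → ℝ}
    (hg : ∀ u v, 0 < u → 0 < v → g (u + v) = g u + g v) {t₀ : ℝ} (ht₀ : 0 < t₀)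
    (hne : g t₀ ≠ g 1 * t₀) {τ y : ℝ} (hτ : 0 < τ) :
    (τ, y) ∈ closure {q : ℝ × ℝ | 0 < q.1 ∧ q.2 = g q.1} := by
  obtain ⟨G, hG⟩ := exists_addMonoidHom_extension hg
  rw [← hG _ ht₀, ← hG 1 one_pos] at hne
  set e := G t₀ - G 1 * t₀ with he
  have he0 : e ≠ 0 := sub_ne_zero.2 hne
  have hrat : ∀ (q : ℚ) (x : ℝ), G (q * x) = q * G x := by
    intro q x
    have := map_rat_smul G q x
    rwa [Rat.smul_def, Rat.smul_def] at this
  rw [Metric.mem_closure_iff]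
  intro δ hδ
  -- The coefficient `r` of `t₀` adjusts the height above the line of slope `G 1`; `q` then adjusts
  -- the abscissa.
  obtain ⟨r, hr⟩ : ∃ r : ℚ, |r * e - (y - G 1 * τ)| < δ / 2 := by
    have hε : 0 < δ / (2 * |e|) := by positivity
    obtain ⟨r, hr1, hr2⟩ := exists_rat_btwn (lt_add_of_pos_right ((y - G 1 * τ) / e) hε)
    refine ⟨r, ?_⟩
    have h1 : |(r : ℝ) - (y - G 1 * τ) / e| < δ / (2 * |e|) := by
      rw [abs_lt]; constructor <;> linarith
    have h2 : r * e - (y - G 1 * τ) = (r - (y - G 1 * τ) / e) * e := by field_simp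
    rw [h2, abs_mul]
    calc _ < δ / (2 * |e|) * |e| := mul_lt_mul_of_pos_right h1 (abs_pos.2 he0)
      _ = δ / 2 := by field_simp
  -- The three bounds keep the abscissa positive, keep it within `δ` of `τ`, and limit the vertical
  -- error it causes to `δ / 2`.
  set ε := min τ (min δ (δ / (2 * (|G 1| + 1)))) with hε
  have hε0 : 0 < ε := by positivity
  obtain ⟨q, hq1, hq2⟩ := exists_rat_btwn (lt_add_of_pos_right (τ - ε - r * t₀) hε0)
  have hclose : |(q : ℝ) * 1 + r * t₀ - τ| < ε := by
    rw [abs_lt]; constructor <;> linarith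
  have hε1 : ε ≤ τ := min_le_left _ _
  have hε2 : ε ≤ δ := (min_le_right _ _).trans (min_le_left _ _)
  have hε3 : ε ≤ δ / (2 * (|G 1| + 1)) := (min_le_right _ _).trans (min_le_right _ _)
  have hpos : 0 < (q : ℝ) * 1 + r * t₀ := by linarith [(abs_lt.1 hclose).1]
  refine ⟨((q : ℝ) * 1 + r * t₀, g (q * 1 + r * t₀)), ⟨hpos, rfl⟩, ?_⟩
  rw [dist_comm, Prod.dist_eq, max_lt_iff, Real.dist_eq, Real.dist_eq]
  refine ⟨hclose.trans_le hε2, ?_⟩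
  change |g (q * 1 + r * t₀) - y| < δ
  rw [← hG _ hpos, map_add, hrat, hrat]
  have h3 : (q : ℝ) * G 1 + r * G t₀ - y
      = G 1 * (q * 1 + r * t₀ - τ) + (r * e - (y - G 1 * τ)) := by rw [he]; ring
  rw [h3]
  refine (abs_add_le _ _).trans_lt ?_
  rw [abs_mul]
  have h4 : |G 1| * |(q : ℝ) * 1 + r * t₀ - τ| ≤ δ / 2 := by
    calc |G 1| * |(q : ℝ) * 1 + r * t₀ - τ| ≤ (|G 1| + 1) * (δ / (2 * (|G 1| + 1))) :=
          mul_le_mul (by linarith) (hclose.le.trans hε3) (abs_nonneg _) (by positivity)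
      _ = δ / 2 := by field_simp
  linarith

/-- A dense graph would be carried to a dense set of values by `(τ, y) ↦ y / (τ ^ (1 / n)) ^ p`,
which is continuous near the abscissa `s₀ ^ n`. The normalization matches `profile_pow`. -/
theorem linear_of_not_dense {n : ℕ} (hn : n ≠ 0) (p : ℝ) {g : ℝ → ℝ}
    (hg : ∀ u v, 0 < u → 0 < v → g (u + v) = g u + g v) {a b : ℝ} (ha : 0 ≤ a) (hab : a < b)
    (hd : ¬ Dense ((fun s : ℝ => g (s ^ n) / s ^ p) '' Set.Ioo a b)) {t : ℝ} (ht : 0 < t) :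
    g t = g 1 * t := by
  by_contra hne
  refine hd (Metric.dense_iff.2 fun Y r hr => ?_)
  set s₀ := (a + b) / 2 with hs₀
  have hs0 : 0 < s₀ := by linarith
  have hroot : (s₀ ^ n) ^ (1 / n : ℝ) = s₀ := by
    rw [one_div, Real.pow_rpow_inv_natCast hs0.le hn]
  have hcl := mem_closure_graph_of_additive hg ht hne (τ := s₀ ^ n) (y := Y * s₀ ^ p)
    (by positivity)
  have hc1 : ContinuousAt (fun q : ℝ × ℝ => q.1 ^ (1 / n : ℝ)) (s₀ ^ n, Y * s₀ ^ p) :=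
    continuousAt_fst.rpow_const (Or.inl (by positivity))
  have hc2 : ContinuousAt (fun q : ℝ × ℝ => q.2 / (q.1 ^ (1 / n : ℝ)) ^ p)
      (s₀ ^ n, Y * s₀ ^ p) := by
    refine continuousAt_snd.div (hc1.rpow_const (Or.inl ?_)) ?_
    · change (s₀ ^ n) ^ (1 / n : ℝ) ≠ 0
      rw [hroot]; exact hs0.ne'
    · change ((s₀ ^ n) ^ (1 / n : ℝ)) ^ p ≠ 0
      rw [hroot]; exact (Real.rpow_pos_of_pos hs0 p).ne'
  have h1 := hc1.eventually (Ioo_mem_nhds (a := a) (b := b)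
    (by change a < (s₀ ^ n) ^ (1 / n : ℝ); rw [hroot]; linarith)
    (by change (s₀ ^ n) ^ (1 / n : ℝ) < b; rw [hroot]; linarith))
  have h2 := hc2.eventually (Metric.ball_mem_nhds _ hr)
  obtain ⟨⟨τ, y⟩, ⟨hτ, hy⟩, h3, h4⟩ :=
    ((mem_closure_iff_frequently.1 hcl).and_eventually (h1.and h2)).exists
  have hτ : 0 < τ := hτ
  have hy : y = g τ := hy
  have h5 : Y * s₀ ^ p / ((s₀ ^ n) ^ (1 / n : ℝ)) ^ p = Y := by
    rw [hroot, mul_div_cancel_right₀ _ (Real.rpow_pos_of_pos hs0 p).ne']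
  refine ⟨y / (τ ^ (1 / n : ℝ)) ^ p, by rw [← h5]; exact h4, τ ^ (1 / n : ℝ), h3, ?_⟩
  simp only
  rw [one_div, Real.rpow_inv_natCast_pow hτ.le hn, hy]

/-! ### The functional equation -/

/-- Write `(a, b, c) = (x y, x z, y z)`. Scaling removes `x`; cyclic shifts then allow `z` and `y`
to be removed in turn. -/
theorem eq_const_of_cyclic_of_scale {W : ℝ → ℝ → ℝ → ℝ}
    (hcyc : ∀ a b c, 0 < a → 0 < b → 0 < c → W a b c = W b c a)
    (hsc : ∀ m a b c, 0 < m → 0 < a → 0 < b → 0 < c → W (m * a) (m * b) c = W a b c)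
    {a b c : ℝ} (ha : 0 < a) (hb : 0 < b) (hc : 0 < c) : W a b c = W 1 1 1 := by
  obtain ⟨x, hx, hxx⟩ : ∃ x, 0 < x ∧ x * x = a * b / c :=
    ⟨√(a * b / c), by positivity, Real.mul_self_sqrt (by positivity)⟩
  have e1 : a = x * (a / x) := by field_simp
  have e2 : b = x * (b / x) := by field_simp
  have e3 : c = (a / x) * (b / x) := by
    rw [div_mul_div_comm, hxx]; field_simp
  have hy : 0 < a / x := by positivity
  have hz : 0 < b / x := by positivity
  generalize a / x = y at *
  generalize b / x = z at *
  rw [e1, e2, e3, hsc x y z _ hx hy hz (by positivity), hcyc y z _ hy hz (by positivity)]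
  have e4 := hsc z 1 y y hz one_pos hy hy
  rw [mul_one, mul_comm z y] at e4
  rw [e4, ← hcyc y 1 y hy one_pos hy, ← hcyc y y 1 hy hy one_pos]
  have e5 := hsc y 1 1 1 hy one_pos one_pos one_pos
  rwa [mul_one] at e5

section FunctionalEquation

variable {n : ℕ} {p : ℝ} {F : ℝ → Rn n → ℝ}

/-- The ratio `r : s = x j : x i`, admissible when the signs agree, makes each term merge the two
coordinates into one, so the support shrinks. -/
theorem split_merge {F : ℝ → Rn n → ℝ} (hF : ∀ i j : Fin n, i ≠ j → ∀ r s : ℝ, 0 < r → 0 < s →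
    ∀ x : Rn n, F (r + s) x = F r (x + (x j * (s / r)) • (stdVec j - stdVec i)) +
      F s (x + (x i * (r / s)) • (stdVec i - stdVec j)))
    {i j : Fin n} (hij : i ≠ j) {t : ℝ} (ht : 0 < t) {x : Rn n} (hx : 0 < x i * x j) :
    F t x = F (t * (x j / (x i + x j))) (x + x i • (stdVec j - stdVec i)) +
      F (t * (x i / (x i + x j))) (x + x j • (stdVec i - stdVec j)) := by
  have key : 0 < x j / (x i + x j) ∧ 0 < x i / (x i + x j) := by
    rcases pos_and_pos_or_neg_and_neg_of_mul_pos hx with ⟨h1, h2⟩ | ⟨h1, h2⟩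
    · exact ⟨by positivity, by positivity⟩
    · exact ⟨div_pos_of_neg_of_neg h2 (by linarith), div_pos_of_neg_of_neg h1 (by linarith)⟩
  have hi : x i ≠ 0 := fun h => by simp [h] at hx
  have hj : x j ≠ 0 := fun h => by simp [h] at hx
  have hs : x i + x j ≠ 0 := fun h => by simp [h] at key
  have h := hF i j hij _ _ (mul_pos ht key.1) (mul_pos ht key.2) x
  have e1 : t * (x j / (x i + x j)) + t * (x i / (x i + x j)) = t := by field_simp; ring
  have e2 : x j * (t * (x i / (x i + x j)) / (t * (x j / (x i + x j)))) = x i := by field_simp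
  have e3 : x i * (t * (x j / (x i + x j)) / (t * (x i / (x i + x j)))) = x j := by field_simp
  rwa [e1, e2, e3] at h

theorem IsProfile.two_coord (hF : IsProfile p F) {i j : Fin n} (hij : i ≠ j) {σ : ℝ} (hσ : σ ≠ 0)
    {t u v : ℝ} (ht : 0 < t) (hu : 0 < u) (hv : 0 < v) (k : Fin n) :
    F t ((σ * u) • stdVec i + (σ * v) • stdVec j) =
      (u + v) ^ p * (F (t * (v / (u + v))) (σ • stdVec k) + F (t * (u / (u + v))) (σ • stdVec k)) := by
  set x : Rn n := (σ * u) • stdVec i + (σ * v) • stdVec j with hx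
  have hxi : x i = σ * u := by simp [hx, hij]
  have hxj : x j = σ * v := by simp [hx, hij.symm]
  have h := split_merge hF.split hij ht (x := x) (by
    rw [hxi, hxj]
    have := mul_self_pos.2 hσ
    have := mul_pos this (mul_pos hu hv)
    nlinarith)
  have huv : 0 < u + v := by positivity
  have e1 : σ * v / (σ * u + σ * v) = v / (u + v) := by field_simp
  have e2 : σ * u / (σ * u + σ * v) = u / (u + v) := by field_simp
  rw [hxi, hxj, e1, e2] at h
  have e3 : x + (σ * u) • (stdVec j - stdVec i) = (u + v) • (σ • stdVec j) := by
    rw [hx]; module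
  have e4 : x + (σ * v) • (stdVec i - stdVec j) = (u + v) • (σ • stdVec i) := by
    rw [hx]; module
  rw [h, e3, e4, hF.hom _ _ _ huv, hF.hom _ _ _ huv, hF.symm _ σ j k, hF.symm _ σ i k]
  ring

/-- The first merge is along `i, j`. The choice `t = a + b + c` cancels the denominators of the
second merge. The left side is symmetric in the three coordinates and the right side is not, which
yields an equation on one axis. -/
theorem IsProfile.three_coord (hF : IsProfile p F) {i j k : Fin n} (hij : i ≠ j) (hik : i ≠ k)
    (hjk : j ≠ k) {σ : ℝ} (hσ : σ ≠ 0) {a b c : ℝ} (ha : 0 < a) (hb : 0 < b) (hc : 0 < c)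
    (l : Fin n) :
    F (a + b + c) ((σ * a) • stdVec i + (σ * b) • stdVec j + (σ * c) • stdVec k) =
      (a + b + c) ^ p * (F (b * c / (a + b)) (σ • stdVec l) + F b (σ • stdVec l) +
        F (a * c / (a + b)) (σ • stdVec l) + F a (σ • stdVec l)) := by
  set x : Rn n := (σ * a) • stdVec i + (σ * b) • stdVec j + (σ * c) • stdVec k with hx
  have hxi : x i = σ * a := by simp [hx, hij, hik]
  have hxj : x j = σ * b := by simp [hx, hij.symm, hjk]
  have h := split_merge hF.split hij (t := a + b + c) (by positivity) (x := x) (by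
    rw [hxi, hxj]
    have := mul_self_pos.2 hσ
    have := mul_pos this (mul_pos ha hb)
    nlinarith)
  have e1 : σ * b / (σ * a + σ * b) = b / (a + b) := by field_simp
  have e2 : σ * a / (σ * a + σ * b) = a / (a + b) := by field_simp
  rw [hxi, hxj, e1, e2] at h
  have e3 : x + (σ * a) • (stdVec j - stdVec i) = (σ * (a + b)) • stdVec j + (σ * c) • stdVec k := by
    rw [hx]; module
  have e4 : x + (σ * b) • (stdVec i - stdVec j) = (σ * (a + b)) • stdVec i + (σ * c) • stdVec k := by
    rw [hx]; module
  rw [h, e3, e4, hF.two_coord hjk hσ (by positivity) (by positivity) hc l,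
    hF.two_coord hik hσ (by positivity) (by positivity) hc l]
  have f1 : (a + b + c) * (b / (a + b)) * (c / (a + b + c)) = b * c / (a + b) := by field_simp
  have f2 : (a + b + c) * (b / (a + b)) * ((a + b) / (a + b + c)) = b := by field_simp
  have f3 : (a + b + c) * (a / (a + b)) * (c / (a + b + c)) = a * c / (a + b) := by field_simp
  have f4 : (a + b + c) * (a / (a + b)) * ((a + b) / (a + b + c)) = a := by field_simp
  rw [f1, f2, f3, f4]
  ring

theorem IsProfile.additive (hF : IsProfile p F) (hn : 3 ≤ n) {σ : ℝ} (hσ : σ ≠ 0) (l : Fin n)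
    {u v : ℝ} (hu : 0 < u) (hv : 0 < v) :
    F (u + v) (σ • stdVec l) = F u (σ • stdVec l) + F v (σ • stdVec l) := by
  let i : Fin n := ⟨0, by omega⟩
  let j : Fin n := ⟨1, by omega⟩
  let k : Fin n := ⟨2, by omega⟩
  have hij : i ≠ j := by simp [i, j]
  have hik : i ≠ k := by simp [i, k]
  have hjk : j ≠ k := by simp [j, k]
  let g : ℝ → ℝ := fun t => F t (σ • stdVec l)
  -- This is the bracket of `three_coord` minus `g a + g b + g c`, hence cyclic; its form is
  -- invariant under scaling `a, b`. At `c = u + v` it is the additivity defect.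
  let W : ℝ → ℝ → ℝ → ℝ := fun a b c => g (b * c / (a + b)) + g (a * c / (a + b)) - g c
  have hcyc : ∀ a b c, 0 < a → 0 < b → 0 < c → W a b c = W b c a := by
    intro a b c ha hb hc
    have h1 := hF.three_coord hij hik hjk hσ ha hb hc l
    have h2 := hF.three_coord hjk hij.symm hik.symm hσ hb hc ha l
    rw [show b + c + a = a + b + c by ring,
      show (σ * b) • (stdVec j : Rn n) + (σ * c) • stdVec k + (σ * a) • stdVec i
        = (σ * a) • stdVec i + (σ * b) • stdVec j + (σ * c) • stdVec k by abel, h1] at h2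
    have h3 := mul_left_cancel₀ (Real.rpow_pos_of_pos (by positivity) p).ne' h2
    simp only [W, g]
    linarith
  have hsc : ∀ m a b c, 0 < m → 0 < a → 0 < b → 0 < c → W (m * a) (m * b) c = W a b c := by
    intro m a b c hm ha hb hc
    have e1 : m * b * c / (m * a + m * b) = b * c / (a + b) := by field_simp
    have e2 : m * a * c / (m * a + m * b) = a * c / (a + b) := by field_simp
    simp only [W, e1, e2]
  have hD : ∀ u v, 0 < u → 0 < v → g v + g u - g (u + v) = W 1 1 1 := by
    intro u v hu hv
    rw [← eq_const_of_cyclic_of_scale hcyc hsc hu hv (add_pos hu hv)]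
    have huv : u + v ≠ 0 := by positivity
    simp only [W, mul_div_cancel_right₀ _ huv]
  -- On the segment between two axis points `F 1` equals `g 1` plus the constant defect; at the
  -- endpoint it is `g 1`, so continuity makes the defect zero.
  have hzero : W 1 1 1 = 0 := by
    have hcont : Continuous fun a : ℝ => F 1 ((σ * a) • stdVec i + (σ * (1 - a)) • stdVec j) :=
      (hF.cont 1).comp (by fun_prop)
    have heq : Set.EqOn (fun a : ℝ => F 1 ((σ * a) • stdVec i + (σ * (1 - a)) • stdVec j))
        (fun _ => g 1 + W 1 1 1) (Set.Ioo 0 1) := by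
      intro a ha
      have h1 : 0 < 1 - a := by linarith [ha.2]
      have := hD a (1 - a) ha.1 h1
      simp only
      rw [hF.two_coord hij hσ one_pos ha.1 h1 l, ← this]
      simp [g]
    have h0 := heq.closure hcont continuous_const
      (by rw [closure_Ioo (zero_ne_one' ℝ)]; simp : (0 : ℝ) ∈ closure (Set.Ioo (0 : ℝ) 1))
    simp only [mul_zero, zero_smul, zero_add, sub_zero, mul_one] at h0
    rw [hF.symm 1 σ j l] at h0
    change g 1 = _ at h0
    linarith
  have := hD u v hu hv
  change g (u + v) = g u + g v
  linarith

/-! ### Propagation from the axes by descent on the support -/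

/-- The number of nonzero coordinates. -/
def suppCard (x : Rn n) : ℕ := (Finset.univ.filter fun i => x i ≠ 0).card

theorem suppCard_lt {x y : Rn n} (h : ∀ l, x l = 0 → y l = 0) {j : Fin n} (hx : x j ≠ 0)
    (hy : y j = 0) : suppCard y < suppCard x := by
  refine Finset.card_lt_card ⟨fun a ha => ?_, fun hsub => ?_⟩
  · simp only [Finset.mem_filter, Finset.mem_univ, true_and] at ha ⊢
    exact fun h0 => ha (h a h0)
  · have := hsub (Finset.mem_filter.2 ⟨Finset.mem_univ j, hx⟩)
    simp [hy] at this

/-- Two coordinates of equal sign are merged. For opposite signs with nonzero sum the equation is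
read backwards, expressing `E t y` by values at a vector of smaller support. Zero sum is reached by
continuity. -/
theorem eq_zero_of_split_of_axes {E : ℝ → Rn n → ℝ} (hcont : ∀ t, Continuous (E t))
    (hsplit : ∀ i j : Fin n, i ≠ j → ∀ r s : ℝ, 0 < r → 0 < s →
      ∀ x : Rn n, E (r + s) x = E r (x + (x j * (s / r)) • (stdVec j - stdVec i)) +
        E s (x + (x i * (r / s)) • (stdVec i - stdVec j)))
    (haxes : ∀ t, 0 < t → ∀ (c : ℝ) (i : Fin n), E t (c • stdVec i) = 0) (hn : 0 < n)
    {t : ℝ} (ht : 0 < t) (x : Rn n) : E t x = 0 := by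
  induction hm : suppCard x using Nat.strong_induction_on generalizing x t with
  | _ m ih =>
    have ih' : ∀ y, suppCard y < m → ∀ r, 0 < r → E r y = 0 := fun y hy r hr => ih _ hy hr y rfl
    have opp : ∀ y : Rn n, suppCard y = m → ∀ i j, i ≠ j → y i ≠ 0 → y j ≠ 0 →
        0 < -(y j) / (y i + y j) → E t y = 0 := by
      intro y hy i j hij hi hj hpos
      set c := y i + y j with hc
      have hc0 : c ≠ 0 := fun h => by simp [h] at hpos
      set z := y + y j • (stdVec i - stdVec j) with hz
      have hzi : z i = c := by simp [hz, hij, hc]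
      have hzj : z j = 0 := by simp [hz, hij.symm]
      have hzs : suppCard z < m := by
        rw [← hy]
        refine suppCard_lt (j := j) (fun l hl => ?_) hj hzj
        have h1 : l ≠ i := by rintro rfl; exact hi hl
        have h2 : l ≠ j := by rintro rfl; exact hj hl
        simp [hz, hl, h1, h2]
      -- With this first parameter and second parameter `t`, splitting at `z` gives `E (r + t) z = E
      -- r z + E t y`.
      have hr : 0 < t * (-(y j) / c) := mul_pos ht hpos
      have h := hsplit i j hij _ t hr ht z
      rw [hzj, zero_mul, zero_smul, add_zero, hzi, ih' z hzs _ hr, ih' z hzs _ (by positivity),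
        zero_add] at h
      have e1 : c * (t * (-(y j) / c) / t) = -(y j) := by field_simp
      rw [e1, hz] at h
      rw [h]
      congr 1
      module
    have nz : ∀ y : Rn n, suppCard y = m → ∀ i j, i ≠ j → y i ≠ 0 → y j ≠ 0 → y i + y j ≠ 0 →
        E t y = 0 := by
      intro y hy i j hij hi hj hij0
      rcases lt_or_gt_of_ne (mul_ne_zero hi hj) with hneg | hpos
      · have h1 : -(y j) / (y i + y j) + -(y i) / (y i + y j) = -1 := by
          field_simp; ring
        -- One of the two ratios is positive, so `opp` applies in one of the two orders.
        have h2 : (-(y j) / (y i + y j)) * (-(y i) / (y i + y j)) < 0 := by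
          have : (-(y j) / (y i + y j)) * (-(y i) / (y i + y j))
            = (y i * y j) / (y i + y j) ^ 2 := by field_simp
          rw [this]
          exact div_neg_of_neg_of_pos hneg (by positivity)
        rcases lt_or_ge 0 (-(y j) / (y i + y j)) with h3 | h3
        · exact opp y hy i j hij hi hj h3
        · refine opp y hy j i hij.symm hj hi ?_
          rw [add_comm (y j)]
          exact pos_of_mul_neg_right h2 h3
      · have key : 0 < y j / (y i + y j) ∧ 0 < y i / (y i + y j) := by
          rcases pos_and_pos_or_neg_and_neg_of_mul_pos hpos with ⟨h1, h2⟩ | ⟨h1, h2⟩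
          · exact ⟨by positivity, by positivity⟩
          · exact ⟨div_pos_of_neg_of_neg h2 (by linarith), div_pos_of_neg_of_neg h1 (by linarith)⟩
        rw [split_merge hsplit hij ht hpos, ih' _ ?_ _ (mul_pos ht key.1),
          ih' _ ?_ _ (mul_pos ht key.2), add_zero]
        · rw [← hy]
          refine suppCard_lt (j := j) (fun l hl => ?_) hj (by simp [hij.symm])
          have h1 : l ≠ i := by rintro rfl; exact hi hl
          have h2 : l ≠ j := by rintro rfl; exact hj hl
          simp [hl, h1, h2]
        · rw [← hy]
          refine suppCard_lt (j := i) (fun l hl => ?_) hi (by simp [hij])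
          have h1 : l ≠ i := by rintro rfl; exact hi hl
          have h2 : l ≠ j := by rintro rfl; exact hj hl
          simp [hl, h1, h2]
    by_cases hex : ∃ i j, i ≠ j ∧ x i ≠ 0 ∧ x j ≠ 0
    · obtain ⟨i, j, hij, hi, hj⟩ := hex
      by_cases hij0 : x i + x j = 0
      · have hc : Continuous fun ε : ℝ => E t (x + ε • stdVec i) :=
          (hcont t).comp (by fun_prop)
        have heq : Set.EqOn (fun ε : ℝ => E t (x + ε • stdVec i)) (fun _ => 0)
            (Set.Ioo 0 |x i|) := by
          intro ε hε
          have hεi : x i + ε ≠ 0 := by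
            intro h0
            have : |x i| = ε := by
              rw [eq_neg_of_add_eq_zero_left h0, abs_neg, abs_of_pos hε.1]
            exact hε.2.ne' this
          refine nz _ ?_ i j hij ?_ ?_ ?_
          · rw [← hm, suppCard, suppCard]
            congr 1
            ext l
            by_cases hl : l = i
            · subst hl; simp [hi, hεi]
            · simp [hl]
          · simpa using hεi
          · simpa [hij.symm] using hj
          · have : x i + ε + x j = ε := by linarith
            simp [hij.symm, this, hε.1.ne']
        have h0 := heq.closure hc continuous_const
          (by
            rw [closure_Ioo (abs_pos.2 hi).ne]
            exact ⟨le_rfl, abs_nonneg _⟩ : (0 : ℝ) ∈ closure (Set.Ioo (0 : ℝ) |x i|))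
        simpa using h0
      · exact nz x hm i j hij hi hj hij0
    · push Not at hex
      by_cases hx : ∃ i, x i ≠ 0
      · obtain ⟨i, hi⟩ := hx
        have : x = x i • stdVec i := by
          ext l
          by_cases hl : l = i
          · subst hl; simp
          · simp [hl, hex i l (Ne.symm hl) hi]
        rw [this]
        exact haxes t ht _ _
      · push Not at hx
        have : x = (0 : ℝ) • stdVec ⟨0, hn⟩ := by
          ext l
          simp [hx]
        rw [this]
        exact haxes t ht _ _

/-- The candidate solves the split equation because it is linear in `t` and `eᵢ - eⱼ` has coordinate
sum zero. It agrees with `F` on the axes, so the difference vanishes. -/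
theorem IsProfile.classification (hF : IsProfile p F) (hn : 3 ≤ n) (hp : 1 < p)
    (hlin : ∀ σ : ℝ, σ ≠ 0 → ∀ i : Fin n,
      (∀ u v, 0 < u → 0 < v → F (u + v) (σ • stdVec i) = F u (σ • stdVec i) + F v (σ • stdVec i)) →
      ∀ t, 0 < t → F t (σ • stdVec i) = F 1 (σ • stdVec i) * t) :
    ∃ c₁ c₂ : ℝ, ∀ t, 0 < t → ∀ x : Rn n,
      F t x = t * (c₁ * max (∑ i, x i) 0 ^ p + c₂ * max (-∑ i, x i) 0 ^ p) := by
  have hp0 : 0 < p := by linarith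
  let i₀ : Fin n := ⟨0, by omega⟩
  let c₁ := F 1 ((1 : ℝ) • stdVec i₀)
  let c₂ := F 1 ((-1 : ℝ) • stdVec i₀)
  let q : ℝ → ℝ := fun s => c₁ * max s 0 ^ p + c₂ * max (-s) 0 ^ p
  have hq : Continuous q := by
    refine (continuous_const.mul ?_).add (continuous_const.mul ?_)
    · exact (continuous_id.max continuous_const).rpow_const fun _ => Or.inr hp0.le
    · exact (continuous_neg.max continuous_const).rpow_const fun _ => Or.inr hp0.le
  have hg : ∀ σ : ℝ, σ ≠ 0 → ∀ t, 0 < t → ∀ i, F t (σ • stdVec i) = F 1 (σ • stdVec i₀) * t := by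
    intro σ hσ t ht i
    rw [hF.symm t σ i i₀]
    exact hlin σ hσ i₀ (fun u v hu hv => hF.additive hn hσ i₀ hu hv) t ht
  refine ⟨c₁, c₂, fun t ht x => ?_⟩
  have hE := eq_zero_of_split_of_axes (E := fun t x => F t x - t * q (∑ i, x i))
    (fun t => (hF.cont t).sub (continuous_const.mul (hq.comp (by fun_prop)))) ?_ ?_
    (by omega) ht x
  · exact sub_eq_zero.1 hE
  · intro i j hij r s hr hs y
    have hsum : ∀ (c : ℝ) (i j : Fin n), ∑ l, (y + c • (stdVec i - stdVec j)) l = ∑ l, y l := by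
      intro c i j
      simp only [PiLp.add_apply, PiLp.smul_apply, PiLp.sub_apply, Finset.sum_add_distrib,
        ← Finset.smul_sum, Finset.sum_sub_distrib]
      simp
    simp only [hsum]
    rw [hF.split i j hij r s hr hs y]
    ring
  · intro t ht c i
    have hsum : ∑ l, (c • (stdVec i : Rn n)) l = c := by
      simp
    simp only [hsum, q]
    rcases lt_trichotomy c 0 with hc | rfl | hc
    · have h1 : c • (stdVec i : Rn n) = (-c) • ((-1 : ℝ) • stdVec i) := by
        rw [smul_smul]; simp
      rw [h1, hF.hom _ _ _ (by linarith), hg _ (by norm_num) t ht i, max_eq_right hc.le,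
        max_eq_left (by linarith), Real.zero_rpow hp0.ne']
      simp only [c₂]
      ring
    · have h1 := hF.hom t 2 0 two_pos
      rw [smul_zero] at h1
      have h2 : (1 : ℝ) < 2 ^ p := Real.one_lt_rpow one_lt_two hp0
      have h3 : F t 0 = 0 := by
        have : (2 ^ p - 1) * F t 0 = 0 := by linarith
        exact (mul_eq_zero.1 this).resolve_left (by linarith)
      simp [h3, Real.zero_rpow hp0.ne']
    · have h1 : c • (stdVec i : Rn n) = c • ((1 : ℝ) • stdVec i) := by rw [one_smul]
      rw [h1, hF.hom _ _ _ hc, hg _ one_ne_zero t ht i, max_eq_left hc.le,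
        max_eq_right (by linarith), Real.zero_rpow hp0.ne']
      simp only [c₁]
      ring

end FunctionalEquation

open MeasureTheory

/-! ### Hyperplane sections and slabs -/

/-- The union of the translates by `s z`, `0 ≤ s < 1`, of the section of `P` by the hyperplane
`⟪x, w⟫ = 1`, for a vector `z` with `⟪z, w⟫ = 1`. -/
def slab {n : ℕ} (P : Set (Rn n)) (w z : Rn n) : Set (Rn n) :=
  {y | (0 ≤ ⟪y, w⟫ - 1 ∧ ⟪y, w⟫ - 1 < 1) ∧ y - (⟪y, w⟫ - 1) • z ∈ P}

theorem measurableSet_slab {n : ℕ} {P : Set (Rn n)} (hP : IsClosed P) (w z : Rn n) :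
    MeasurableSet (slab P w z) := by
  have hc : Continuous fun y : Rn n => ⟪y, w⟫ - 1 := by fun_prop
  exact ((measurableSet_le measurable_const hc.measurable).inter
    (measurableSet_lt hc.measurable measurable_const)).inter (hP.measurableSet.preimage
      (by fun_prop : Measurable fun y : Rn n => y - (⟪y, w⟫ - 1) • z))

/-- Slicing orthogonally to `w` gives translates of one section over a height `1 / ‖w‖`. This turns
facet volume into Lebesgue measure, whose behaviour under linear maps is the determinant. -/
theorem volume_slab {n : ℕ} {P : Set (Rn n)} (hP : IsClosed P) {w z : Rn n} (hz : ⟪z, w⟫ = 1) :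
    volume (slab P w z) = ENNReal.ofReal (1 / ‖w‖) * μHE[n - 1] (P ∩ {x | ⟪x, w⟫ = 1}) := by
  have hw : w ≠ 0 := by rintro rfl; simp at hz
  have hw' : 0 < ‖w‖ := norm_pos_iff.2 hw
  have h := EuclideanGeometry.euclideanHausdorffMeasure_eq_lintegral (0 : Rn n) hw
    (measurableSet_slab hP w z)
  rw [InnerProductSpace.euclideanHausdorffMeasure_eq_volume] at h
  rw [h]
  have hslice : ∀ x : ℝ, μHE[Module.finrank ℝ (Rn n) - 1]
      (slab P w z ∩ AffineSubspace.mk' (x • w +ᵥ (0 : Rn n)) (ℝ ∙ w)ᗮ) =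
      (Set.Ico (1 / ‖w‖ ^ 2) (2 / ‖w‖ ^ 2)).indicator
        (fun _ => μHE[n - 1] (P ∩ {x | ⟪x, w⟫ = 1})) x := by
    intro x
    rw [finrank_euclideanSpace_fin]
    have hmem : ∀ y : Rn n, y ∈ AffineSubspace.mk' (x • w +ᵥ (0 : Rn n)) (ℝ ∙ w)ᗮ ↔
        ⟪y, w⟫ = x * ‖w‖ ^ 2 := by
      intro y
      rw [AffineSubspace.mem_mk', Submodule.mem_orthogonal_singleton_iff_inner_left]
      simp only [vadd_eq_add, add_zero, vsub_eq_sub, inner_sub_left, real_inner_smul_left,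
        real_inner_self_eq_norm_sq, sub_eq_zero]
    by_cases hx : x ∈ Set.Ico (1 / ‖w‖ ^ 2) (2 / ‖w‖ ^ 2)
    · rw [Set.indicator_of_mem hx]
      rw [Set.mem_Ico, div_le_iff₀ (by positivity), lt_div_iff₀ (by positivity)] at hx
      have : slab P w z ∩ AffineSubspace.mk' (x • w +ᵥ (0 : Rn n)) (ℝ ∙ w)ᗮ =
          (fun y => ((x * ‖w‖ ^ 2 - 1) • z) + y) '' (P ∩ {x | ⟪x, w⟫ = 1}) := by
        ext y
        rw [Set.image_add_left]
        simp only [Set.mem_inter_iff, SetLike.mem_coe, hmem, slab, Set.mem_ofPred_eq,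
          Set.mem_preimage]
        constructor
        · rintro ⟨⟨-, h2⟩, h3⟩
          rw [h3] at h2
          refine ⟨by rwa [neg_add_eq_sub], ?_⟩
          rw [inner_add_left, inner_neg_left, real_inner_smul_left, hz, h3]; ring
        · rintro ⟨h1, h2⟩
          rw [inner_add_left, inner_neg_left, real_inner_smul_left, hz] at h2
          have h3 : ⟪y, w⟫ = x * ‖w‖ ^ 2 := by linarith
          refine ⟨⟨⟨by linarith, by linarith⟩, ?_⟩, h3⟩
          rw [h3, ← neg_add_eq_sub]
          exact h1
      rw [this]
      exact (isometry_add_left _).euclideanHausdorffMeasure_image _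
    · rw [Set.indicator_of_notMem hx]
      have : slab P w z ∩ AffineSubspace.mk' (x • w +ᵥ (0 : Rn n)) (ℝ ∙ w)ᗮ = ∅ := by
        rw [Set.eq_empty_iff_forall_notMem]
        rintro y ⟨⟨⟨h1, h2⟩, -⟩, h3⟩
        have h3 := (hmem y).1 h3
        refine hx ?_
        rw [Set.mem_Ico, div_le_iff₀ (by positivity), lt_div_iff₀ (by positivity)]
        exact ⟨by linarith, by linarith⟩
      rw [this, measure_empty]
  simp only [hslice]
  rw [lintegral_indicator measurableSet_Ico, lintegral_const, Measure.restrict_apply_univ,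
    Real.volume_Ico, mul_comm (μHE[n - 1] _), ← mul_assoc]
  congr 1
  rw [← ofReal_norm, ← ENNReal.ofReal_mul hw'.le]
  congr 1
  field_simp
  norm_num

theorem slab_volume_lt_top {n : ℕ} {P : Set (Rn n)} (hP : Bornology.IsBounded P) (w z : Rn n) :
    volume (slab P w z) < ⊤ := by
  refine Bornology.IsBounded.measure_lt_top ?_
  obtain ⟨C, hC⟩ := hP.exists_norm_le
  refine isBounded_iff_forall_norm_le.2 ⟨C + ‖z‖, fun y hy => ?_⟩
  have h1 := hC _ hy.2
  have h2 : ‖(⟪y, w⟫ - 1) • z‖ ≤ ‖z‖ := by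
    rw [norm_smul, Real.norm_of_nonneg hy.1.1]
    exact mul_le_of_le_one_left (norm_nonneg _) hy.1.2.le
  calc ‖y‖ = ‖(y - (⟪y, w⟫ - 1) • z) + (⟪y, w⟫ - 1) • z‖ := by rw [sub_add_cancel]
    _ ≤ _ := (norm_add_le _ _).trans (add_le_add h1 h2)

theorem section_lt_top {n : ℕ} {P : Set (Rn n)} (hP : IsCompact P) {v : Rn n} (hv : v ≠ 0)
    {h : ℝ} (hh : h ≠ 0) : μHE[n - 1] (P ∩ {x | ⟪x, v⟫ = h}) < ⊤ := by
  have hv' : 0 < ‖v‖ := norm_pos_iff.2 hv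
  have hz : ⟪(h / ‖v‖ ^ 2) • v, h⁻¹ • v⟫ = 1 := by
    rw [real_inner_smul_left, real_inner_smul_right, real_inner_self_eq_norm_sq]
    field_simp
  have e : {x : Rn n | ⟪x, h⁻¹ • v⟫ = 1} = {x | ⟪x, v⟫ = h} := by
    ext x
    simp only [Set.mem_ofPred_eq, real_inner_smul_right]
    rw [inv_mul_eq_one₀ hh, eq_comm]
  have h1 := volume_slab hP.isClosed hz
  have h2 := slab_volume_lt_top hP.isBounded (h⁻¹ • v) ((h / ‖v‖ ^ 2) • v)
  rw [h1, e] at h2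
  refine (ENNReal.lt_top_of_mul_ne_top_right h2.ne ?_)
  rw [ne_eq, ENNReal.ofReal_eq_zero, not_le]
  have : h⁻¹ • v ≠ 0 := smul_ne_zero (inv_ne_zero hh) hv
  positivity

/-- With the translation vector taken in `F`, the slab over `ker l` stays in `ker l`, a Lebesgue
null set. -/
theorem section_ker_eq_zero {n : ℕ} {l : Rn n →ₗ[ℝ] ℝ} (hl : l ≠ 0) {v : Rn n} {h : ℝ}
    (hh : h ≠ 0) {F : Set (Rn n)} (hF : ∀ x ∈ F, l x = 0 ∧ ⟪x, v⟫ = h) : μHE[n - 1] F = 0 := by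
  rcases F.eq_empty_or_nonempty with rfl | ⟨z, hzF⟩
  · exact measure_empty
  obtain ⟨hlz, hzv⟩ := hF z hzF
  have hz : ⟪z, h⁻¹ • v⟫ = 1 := by
    rw [real_inner_smul_right, hzv, inv_mul_cancel₀ hh]
  have hv : h⁻¹ • v ≠ 0 := by intro h0; rw [h0] at hz; simp at hz
  have h1 := volume_slab (Submodule.closed_of_finiteDimensional (LinearMap.ker l)) hz
  have h2 : volume (slab (LinearMap.ker l : Set (Rn n)) (h⁻¹ • v) z) = 0 := by
    refine measure_mono_null ?_ (Measure.addHaar_submodule volume (LinearMap.ker l)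
      (fun h => hl (LinearMap.ker_eq_top.1 h)))
    rintro y ⟨-, hy⟩
    have hy : l (y - (⟪y, h⁻¹ • v⟫ - 1) • z) = 0 := hy
    rw [map_sub, map_smul, hlz, smul_zero, sub_zero] at hy
    exact hy
  rw [h2] at h1
  have h3 := (mul_eq_zero.1 h1.symm).resolve_left (by
    rw [ENNReal.ofReal_eq_zero, not_le]
    positivity)
  have hsub : F ⊆ (LinearMap.ker l : Set (Rn n)) ∩ {x | ⟪x, h⁻¹ • v⟫ = 1} := by
    refine fun x hx => ⟨(hF x hx).1, ?_⟩
    change ⟪x, h⁻¹ • v⟫ = 1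
    rw [real_inner_smul_right, (hF x hx).2, inv_mul_cancel₀ hh]
  exact measure_mono_null hsub h3

/-! ### The sum defining the projection bodies as a sum over all unit vectors -/

theorem supportFn_le {n : ℕ} (P : PolytopeO n) {v : Rn n} {c : ℝ}
    (h : ∀ x ∈ P.1, ⟪x, v⟫ ≤ c) : supportFn P.1 v ≤ c :=
  csSup_le (Set.Nonempty.image _ ⟨0, P.2.2⟩) (by rintro _ ⟨x, hx, rfl⟩; exact h x hx)

theorem supportFn_eq {n : ℕ} (P : PolytopeO n) {v x : Rn n} (hx : x ∈ P.1)
    (h : ∀ y ∈ P.1, ⟪y, v⟫ ≤ ⟪x, v⟫) : supportFn P.1 v = ⟪x, v⟫ :=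
  le_antisymm (supportFn_le P h) (le_supportFn P v hx)

theorem face_nonempty {n : ℕ} (P : PolytopeO n) (v : Rn n) : (face P.1 v).Nonempty := by
  obtain ⟨x, hx, hmax⟩ := P.isCompact.exists_isMaxOn ⟨0, P.2.2⟩
    (by fun_prop : ContinuousOn (fun x : Rn n => ⟪x, v⟫) P.1)
  exact ⟨x, hx, (supportFn_eq P hx hmax).symm⟩

theorem zero_mem_face_iff {n : ℕ} (P : PolytopeO n) (v : Rn n) :
    (0 : Rn n) ∈ face P.1 v ↔ supportFn P.1 v = 0 := by
  simp [face, P.2.2, eq_comm]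

/-- The coefficient of the unit vector `v` in the sum defining the projection bodies. -/
def facetCoeff {n : ℕ} (p : ℝ) (v : Rn n) (P : PolytopeO n) : ℝ :=
  open Classical in
  if ‖v‖ = 1 ∧ supportFn P.1 v ≠ 0 then facetVol (face P.1 v) * supportFn P.1 v ^ (1 - p) else 0

theorem facetCoeff_eq_zero_of_subset_ker {n : ℕ} (p : ℝ) {v : Rn n} {P : PolytopeO n}
    {l : Rn n →ₗ[ℝ] ℝ} (hl : l ≠ 0) (h : ∀ x ∈ face P.1 v, l x = 0) : facetCoeff p v P = 0 := by
  rw [facetCoeff]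
  split_ifs with hv
  · rw [facetVol, section_ker_eq_zero hl hv.2 fun x hx => ⟨h x hx, hx.2⟩]
    simp
  · rfl

theorem exists_functional_of_finrank_span_lt {n : ℕ} {s : Set (Rn n)}
    (h : Module.finrank ℝ (Submodule.span ℝ s) < n) :
    ∃ l : Rn n →ₗ[ℝ] ℝ, l ≠ 0 ∧ ∀ x ∈ s, l x = 0 := by
  obtain ⟨l, hl, hs⟩ := Submodule.exists_le_ker_of_lt_top (Submodule.span ℝ s)
    (lt_top_iff_ne_top.2 (by
      intro h'
      rw [h', finrank_top, finrank_euclideanSpace_fin] at h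
      exact h.false))
  exact ⟨l, hl, fun x hx => hs (Submodule.subset_span hx)⟩

/-- A face lying in a hyperplane through the origin contributes nothing. Otherwise it spans the
whole space, so its direction space has dimension at least `n - 1`, and it lies in `vᗮ`. -/
theorem mem_facetNormals_of_facetCoeff_ne_zero {n : ℕ} {p : ℝ} {v : Rn n} {P : PolytopeO n}
    (h : facetCoeff p v P ≠ 0) :
    v ∈ facetNormals P.1 ∧ (0 : Rn n) ∉ face P.1 v := by
  have hv : ‖v‖ = 1 ∧ supportFn P.1 v ≠ 0 := by
    by_contra hcon
    exact h (if_neg hcon)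
  refine ⟨⟨hv.1, ?_⟩, fun h0 => hv.2 ((zero_mem_face_iff P v).1 h0)⟩
  obtain ⟨y, hy⟩ := face_nonempty P v
  have hspan : ¬ Module.finrank ℝ (Submodule.span ℝ (face P.1 v)) < n := fun hlt => by
    obtain ⟨l, hl, h0⟩ := exists_functional_of_finrank_span_lt hlt
    exact h (facetCoeff_eq_zero_of_subset_ker p hl h0)
  have hle : Submodule.span ℝ (face P.1 v) ≤ vectorSpan ℝ (face P.1 v) ⊔ Submodule.span ℝ {y} := by
    refine Submodule.span_le.2 fun x hx => ?_
    have : x = (x -ᵥ y) + y := by simp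
    rw [this]
    exact Submodule.add_mem_sup (vsub_mem_vectorSpan ℝ hx hy)
      (Submodule.mem_span_singleton_self y)
  have h1 := Submodule.finrank_mono hle
  have h2 := Submodule.finrank_add_le_finrank_add_finrank (vectorSpan ℝ (face P.1 v))
    (Submodule.span ℝ {y})
  have h3 := finrank_span_le_card (R := ℝ) ({y} : Set (Rn n))
  simp at h3
  have hv0 : v ≠ 0 := by
    rintro rfl
    simpa using hv.1
  have h4 : vectorSpan ℝ (face P.1 v) ≤ (ℝ ∙ v)ᗮ := by
    rw [vectorSpan_def, Submodule.span_le]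
    rintro _ ⟨a, ha, b, hb, rfl⟩
    have e1 : ⟪a, v⟫ = supportFn P.1 v := ha.2
    have e2 : ⟪b, v⟫ = supportFn P.1 v := hb.2
    rw [SetLike.mem_coe, Submodule.mem_orthogonal_singleton_iff_inner_left]
    simp [inner_sub_left, e1, e2]
  have h5 := Submodule.finrank_mono h4
  have h6 := Submodule.finrank_add_finrank_orthogonal (ℝ ∙ v)
  rw [finrank_span_singleton hv0, finrank_euclideanSpace_fin] at h6
  omega

theorem finite_support_facetCoeff {n : ℕ} (p : ℝ) (P : PolytopeO n) :
    (Function.support fun v => facetCoeff p v P).Finite :=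
  (facetNormals_finite P).subset fun _ hv => (mem_facetNormals_of_facetCoeff_ne_zero hv).1

/-- The index set no longer depends on `P`, so additivity can be checked separately for each `v`. -/
theorem projSum_eq_finsum {n : ℕ} (τ : ℝ → ℝ) (p : ℝ) (P : PolytopeO n) (u : Rn n) :
    projSum τ p P u = ∑ᶠ v, facetCoeff p v P * τ ⟪v, u⟫ ^ p := by
  rw [projSum, finsum_mem_def]
  refine finsum_congr fun v => ?_
  by_cases hv : v ∈ {v : Rn n | v ∈ facetNormals P.1 ∧ (0 : Rn n) ∉ face P.1 v}
  · rw [Set.indicator_of_mem hv, facetCoeff,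
      if_pos ⟨hv.1.1, fun h => hv.2 ((zero_mem_face_iff P v).2 h)⟩]
  · rw [Set.indicator_of_notMem hv]
    have : facetCoeff p v P = 0 := by
      by_contra h
      exact hv (mem_facetNormals_of_facetCoeff_ne_zero h)
    rw [this, zero_mul]

theorem projSum_eq_zero_of_finrank_lt {n : ℕ} (τ : ℝ → ℝ) (p : ℝ) (u : Rn n) :
    VanishesBelow n fun P => projSum τ p P u := by
  intro P hP
  obtain ⟨l, hl, h0⟩ := exists_functional_of_finrank_span_lt hP
  simp only [projSum_eq_finsum, facetCoeff_eq_zero_of_subset_ker p hl fun x hx => h0 x hx.1,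
    zero_mul, finsum_zero]

/-- If the face meets the halfspace, the support value is unchanged. If not, the face of the cut
polytope lies in `ker l` and is null. -/
theorem facetCoeff_cut {n : ℕ} (p : ℝ) {v : Rn n} (P : PolytopeO n) {l : Rn n →ₗ[ℝ] ℝ}
    (hl : l ≠ 0) (hv : ‖v‖ = 1) (h : supportFn P.1 v ≠ 0) :
    facetCoeff p v (P.cut l) =
      facetVol (face P.1 v ∩ {x | 0 ≤ l x}) * supportFn P.1 v ^ (1 - p) := by
  by_cases hx : ∃ x ∈ face P.1 v, 0 ≤ l x
  · obtain ⟨x, hx, hlx⟩ := hx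
    have hs : supportFn (P.cut l).1 v = supportFn P.1 v := by
      have hx2 : ⟪x, v⟫ = supportFn P.1 v := hx.2
      rw [← hx2]
      exact supportFn_eq _ ⟨hx.1, hlx⟩ fun y hy => hx2 ▸ le_supportFn P v hy.1
    have hf : face (P.cut l).1 v = face P.1 v ∩ {x | 0 ≤ l x} := by
      rw [face, hs, face]
      ext y
      simp only [PolytopeO.cut, Set.mem_inter_iff]
      tauto
    rw [facetCoeff, if_pos ⟨hv, by rwa [hs]⟩, hs, hf]
  · push Not at hx
    have hempty : face P.1 v ∩ {x | 0 ≤ l x} = ∅ :=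
      Set.eq_empty_iff_forall_notMem.2 fun x hx' => (hx x hx'.1).not_ge hx'.2
    rw [hempty, facetVol, measure_empty, ENNReal.toReal_zero, zero_mul]
    refine facetCoeff_eq_zero_of_subset_ker p hl fun y hy => ?_
    by_contra hne
    have hly : 0 ≤ l y := hy.1.2
    have hly : 0 < l y := lt_of_le_of_ne hly (Ne.symm hne)
    obtain ⟨x, hxF⟩ := face_nonempty P v
    have hlx := hx x hxF
    have hd : 0 < l y - l x := by linarith
    have hc0 : 0 ≤ l y / (l y - l x) := by positivity
    have hc1 : 0 ≤ -l x / (l y - l x) := div_nonneg (by linarith) hd.le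
    have hsum : l y / (l y - l x) + -l x / (l y - l x) = 1 := by field_simp; ring
    have hyP : y ∈ P.1 := hy.1.1
    -- The segment from the old face to `y` crosses `ker l` inside the cut polytope; maximality of
    -- `y` there would put `y` in the old face.
    have hm : (l y / (l y - l x)) • x + (-l x / (l y - l x)) • y ∈ (P.cut l).1 := by
      refine ⟨P.convex hxF.1 hyP hc0 hc1 hsum, ?_⟩
      change 0 ≤ l _
      rw [map_add, map_smul, map_smul, smul_eq_mul, smul_eq_mul]
      have : l y / (l y - l x) * l x + -l x / (l y - l x) * l y = 0 := by field_simp; ring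
      rw [this]
    have h1 := le_supportFn (P.cut l) v hm
    have h2 : ⟪y, v⟫ = supportFn (P.cut l).1 v := hy.2
    have h3 : ⟪x, v⟫ = supportFn P.1 v := hxF.2
    rw [← h2, inner_add_left, real_inner_smul_left, real_inner_smul_left] at h1
    have h4 : ⟪x, v⟫ ≤ ⟪y, v⟫ := by
      have h5 : -l x / (l y - l x) = 1 - l y / (l y - l x) := by linarith
      rw [h5] at h1
      have h6 : l y / (l y - l x) * (⟪x, v⟫ - ⟪y, v⟫) ≤ 0 := by linarith
      have h7 : 0 < l y / (l y - l x) := by positivity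
      linarith [nonpos_of_mul_nonpos_right h6 h7]
    have hyF : y ∈ face P.1 v := ⟨hyP, le_antisymm (le_supportFn P v hyP) (h3 ▸ h4)⟩
    exact (hx y hyF).not_gt hly

theorem facetCoeff_eq_add {n : ℕ} (p : ℝ) (v : Rn n) (P : PolytopeO n) {l : Rn n →ₗ[ℝ] ℝ}
    (hl : l ≠ 0) :
    facetCoeff p v P = facetCoeff p v (P.cut l) + facetCoeff p v (P.cut (-l)) := by
  by_cases hv : ‖v‖ = 1
  swap
  · simp [facetCoeff, hv]
  by_cases h : supportFn P.1 v = 0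
  · have hz : ∀ l : Rn n →ₗ[ℝ] ℝ, supportFn (P.cut l).1 v = 0 := fun l =>
      le_antisymm (supportFn_le _ fun x hx => h ▸ le_supportFn P v hx.1) (supportFn_nonneg _ _)
    simp [facetCoeff, h, hz]
  rw [facetCoeff_cut p P hl hv h, facetCoeff_cut p P (neg_ne_zero.2 hl) hv h, facetCoeff,
    if_pos ⟨hv, h⟩, ← add_mul]
  congr 1
  have hv0 : v ≠ 0 := by
    rintro rfl
    simp at hv
  have hfin : μHE[n - 1] (face P.1 v) < ⊤ := section_lt_top P.isCompact hv0 h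
  have hm : MeasurableSet {x : Rn n | 0 ≤ l x} :=
    (isClosed_le continuous_const (LinearMap.continuous_of_finiteDimensional l)).measurableSet
  have h1 := measure_inter_add_sdiff (μ := μHE[n - 1]) (face P.1 v) hm
  have h2 := measure_inter_add_sdiff (μ := μHE[n - 1]) (face P.1 v ∩ {x | 0 ≤ (-l) x}) hm
  have h3 : μHE[n - 1] (face P.1 v ∩ {x | 0 ≤ (-l) x} ∩ {x | 0 ≤ l x}) = 0 := by
    refine section_ker_eq_zero hl h fun x hx => ⟨?_, hx.1.1.2⟩
    have e1 : 0 ≤ -l x := hx.1.2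
    have e2 : 0 ≤ l x := hx.2
    linarith
  have h4 : (face P.1 v ∩ {x | 0 ≤ (-l) x}) \ {x | 0 ≤ l x} = face P.1 v \ {x | 0 ≤ l x} := by
    ext x
    simp only [Set.mem_sdiff, Set.mem_inter_iff, Set.mem_ofPred_eq, LinearMap.neg_apply]
    constructor
    · tauto
    · rintro ⟨a, b⟩
      exact ⟨⟨a, by linarith⟩, b⟩
  rw [h3, h4, zero_add] at h2
  rw [h2] at h1
  rw [facetVol, facetVol, facetVol, ← h1, ENNReal.toReal_add]
  · exact ((measure_mono Set.inter_subset_left).trans_lt hfin).ne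
  · exact ((measure_mono Set.inter_subset_left).trans_lt hfin).ne

theorem isCutAdditive_projSum {n : ℕ} (τ : ℝ → ℝ) (p : ℝ) (u : Rn n) :
    IsCutAdditive fun P => projSum τ p P u := by
  intro P l hl
  have h0 : projSum τ p ((P.cut l).cut (-l)) u = 0 := by
    rw [projSum_eq_finsum]
    refine (finsum_congr fun v => ?_).trans finsum_zero
    rw [facetCoeff_eq_zero_of_subset_ker p hl fun x hx => ?_, zero_mul]
    have e1 : 0 ≤ -l x := hx.1.2
    have e2 : 0 ≤ l x := hx.1.1.2
    linarith
  have hfin : ∀ P : PolytopeO n,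
      (Function.support fun v => facetCoeff p v P * τ ⟪v, u⟫ ^ p).Finite := fun P =>
    (finite_support_facetCoeff p P).subset fun v hv h => hv (by
      simp only at h ⊢
      rw [h, zero_mul])
  simp only [h0, add_zero]
  rw [projSum_eq_finsum, projSum_eq_finsum, projSum_eq_finsum,
    ← finsum_add_distrib (hfin _) (hfin _)]
  refine finsum_congr fun v => ?_
  rw [facetCoeff_eq_add p v P hl, add_mul]

/-! ### The projection bodies of simplices -/

theorem exists_inner_eq_one {n : ℕ} {b : Fin n → Rn n} (hb : LinearIndependent ℝ b) :
    ∃ w : Rn n, ∀ i, ⟪b i, w⟫ = 1 := by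
  obtain ⟨f, hf⟩ := exists_functional hb fun _ => 1
  refine ⟨(InnerProductSpace.toDual ℝ (Rn n)).symm (LinearMap.toContinuousLinearMap f), fun i => ?_⟩
  rw [real_inner_comm, InnerProductSpace.toDual_symm_apply]
  exact hf i

theorem bijective_of_det_ne_zero {n : ℕ} {A : Rn n →ₗ[ℝ] Rn n} (hA : LinearMap.det A ≠ 0) :
    Function.Bijective A :=
  (LinearMap.equivOfDetNeZero A hA).bijective

/-- The slab over the facet of the standard simplex that does not contain the origin. -/
def stdSlab (n : ℕ) (i : Fin n) : Set (Rn n) :=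
  slab (stdSimplexO n).1 (∑ j, stdVec j) (stdVec i)

theorem inner_sum_stdVec {n : ℕ} (x : Rn n) : ⟪x, ∑ j, stdVec j⟫ = ∑ j, x j := by
  rw [inner_sum]
  simp [EuclideanSpace.inner_single_right]

theorem mem_stdSimplexO {n : ℕ} {x : Rn n} :
    x ∈ (stdSimplexO n).1 ↔ (∀ i, 0 ≤ x i) ∧ ∑ i, x i ≤ 1 := by
  rw [stdSimplexO_eq, mem_simplexO]
  constructor
  · rintro ⟨c, hc, hc1, rfl⟩
    have : ∀ j, (∑ i, c i • (stdVec i : Rn n)) j = c j := fun j => by simp [Pi.single_apply]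
    simp only [this]
    exact ⟨hc, hc1⟩
  · rintro ⟨h1, h2⟩
    exact ⟨fun i => x i, h1, h2, sum_smul_stdVec x⟩

theorem volume_stdSlab_pos {n : ℕ} (i : Fin n) : 0 < volume (stdSlab n i) := by
  let U : Set (Rn n) := {y | (∀ j, 0 < y j) ∧ 1 < ∑ j, y j ∧ ∑ j, y j < 2 ∧ ∑ j, y j < 1 + y i}
  have hsum : Continuous fun y : Rn n => ∑ j, y j := by fun_prop
  have hU : IsOpen U := by
    have : U = (⋂ j, {y : Rn n | 0 < y j}) ∩ ({y | 1 < ∑ j, y j} ∩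
        ({y | ∑ j, y j < 2} ∩ {y | ∑ j, y j < 1 + y i})) := by
      ext y
      simp [U]
    rw [this]
    refine (isOpen_iInter_of_finite fun j => isOpen_lt continuous_const (by fun_prop)).inter
      ((isOpen_lt continuous_const hsum).inter ((isOpen_lt hsum continuous_const).inter
        (isOpen_lt hsum (by fun_prop))))
  have hn : 0 < (n : ℝ) := by exact_mod_cast i.pos
  have hne : U.Nonempty := by
    -- The point `eᵢ + ε ∑ eⱼ` has coordinate sum `3 / 2`, halfway up the slab.
    let ε : ℝ := 1 / (2 * n)
    have hε : 0 < ε := by positivity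
    refine ⟨WithLp.toLp 2 (fun j => ε + if j = i then 1 else 0), ?_⟩
    have hs : ∑ j : Fin n, (ε + if j = i then (1 : ℝ) else 0) = 3 / 2 := by
      rw [Finset.sum_add_distrib]
      simp [ε]
      field_simp
      norm_num
    refine ⟨fun j => ?_, ?_, ?_, ?_⟩
    · change 0 < ε + if j = i then (1 : ℝ) else 0
      split_ifs <;> linarith
    · change 1 < ∑ j : Fin n, (ε + if j = i then (1 : ℝ) else 0)
      rw [hs]; norm_num
    · change ∑ j : Fin n, (ε + if j = i then (1 : ℝ) else 0) < 2
      rw [hs]; norm_num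
    · change ∑ j : Fin n, (ε + if j = i then (1 : ℝ) else 0) < 1 + (ε + if i = i then (1 : ℝ) else 0)
      rw [hs, if_pos rfl]; linarith
  refine (hU.measure_pos volume hne).trans_le (measure_mono ?_)
  rintro y ⟨h1, h2, h3, h4⟩
  have hin := inner_sum_stdVec y
  refine ⟨⟨by rw [hin]; linarith, by rw [hin]; linarith⟩, ?_⟩
  rw [hin, mem_stdSimplexO]
  constructor
  · intro j
    by_cases hj : j = i
    · subst hj; simp; linarith
    · simpa [hj] using (h1 j).le
  · simp [Finset.sum_sub_distrib]

theorem image_stdSlab {n : ℕ} {A : Rn n →ₗ[ℝ] Rn n} (hA : LinearMap.det A ≠ 0) {w : Rn n}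
    (hw : ∀ i, ⟪A (stdVec i), w⟫ = 1) (i : Fin n) :
    slab ((stdSimplexO n).map A).1 w (A (stdVec i)) = A '' stdSlab n i := by
  have hin : ∀ x, ⟪A x, w⟫ = ⟪x, ∑ j, stdVec j⟫ := by
    intro x
    rw [inner_sum_stdVec]
    conv_lhs => rw [← sum_smul_stdVec x, map_sum, sum_inner]
    simp only [map_smul, real_inner_smul_left, hw, mul_one]
  have hinj : Function.Injective A := (bijective_of_det_ne_zero hA).1
  have hsurj : Function.Surjective A := (bijective_of_det_ne_zero hA).2
  ext y
  obtain ⟨x, rfl⟩ := hsurj y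
  rw [hinj.mem_set_image]
  simp only [slab, stdSlab, Set.mem_ofPred_eq, hin]
  rw [← map_smul, ← map_sub]
  exact and_congr_right fun _ => hinj.mem_set_image

/-- The slab over the facet is the image of the standard slab under `A`, so no facet area has to be
computed. -/
theorem facetVol_section_div {n : ℕ} {A : Rn n →ₗ[ℝ] Rn n} (hA : 0 < LinearMap.det A) {w : Rn n}
    (hw : ∀ i, ⟪A (stdVec i), w⟫ = 1) (i : Fin n) :
    facetVol (((stdSimplexO n).map A).1 ∩ {x | ⟪x, w⟫ = 1}) / ‖w‖ =
      LinearMap.det A * (volume (stdSlab n i)).toReal := by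
  have h := volume_slab ((stdSimplexO n).map A).isCompact.isClosed (hw i)
  rw [image_stdSlab hA.ne' hw i, Measure.addHaar_image_linearMap] at h
  have h2 := congrArg ENNReal.toReal h
  rw [ENNReal.toReal_mul, ENNReal.toReal_mul, ENNReal.toReal_ofReal (abs_nonneg _),
    ENNReal.toReal_ofReal (by positivity), abs_of_pos hA] at h2
  rw [h2, facetVol]
  ring

/-- A face containing all `b i` and not the origin has normal proportional to `w`. A face missing
the origin and some `b i` lies in the span of the other vertices. -/
theorem facetCoeff_simplexO_eq_zero {n : ℕ} (p : ℝ) {b : Fin n → Rn n}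
    (hb : LinearIndependent ℝ b) {w : Rn n} (hw : ∀ i, ⟪b i, w⟫ = 1) {v : Rn n}
    (hv : v ≠ ‖w‖⁻¹ • w) : facetCoeff p v (simplexO b) = 0 := by
  classical
  by_cases hall : ∀ i, b i ∈ face (simplexO b).1 v
  · by_contra hne
    have hvn : ‖v‖ = 1 ∧ supportFn (simplexO b).1 v ≠ 0 := by
      by_contra hcon
      exact hne (if_neg hcon)
    set h := supportFn (simplexO b).1 v with hh
    have hh0 : 0 < h := lt_of_le_of_ne (supportFn_nonneg _ v) (Ne.symm hvn.2)
    have hvw : v = h • w := by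
      have hz : ∀ i, ⟪b i, v - h • w⟫ = 0 := fun i => by
        have : ⟪b i, v⟫ = h := (hall i).2
        rw [inner_sub_right, real_inner_smul_right, hw, this]; ring
      have htop : Submodule.span ℝ (Set.range b) = ⊤ :=
        hb.span_eq_top_of_card_eq_finrank' (by simp)
      have hmem : v - h • w ∈ Submodule.span ℝ (Set.range b) := by rw [htop]; trivial
      have h0 : ⟪v - h • w, v - h • w⟫ = 0 := by
        obtain ⟨c, hc⟩ := (Submodule.mem_span_range_iff_exists_fun ℝ).1 hmem
        nth_rw 1 [← hc]
        simp [sum_inner, real_inner_smul_left, hz]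
      exact sub_eq_zero.1 (inner_self_eq_zero.1 h0)
    have hn : h * ‖w‖ = 1 := by
      rw [← hvn.1, hvw, norm_smul, Real.norm_of_nonneg hh0.le]
    refine hv ?_
    rw [hvw, eq_inv_of_mul_eq_one_left hn]
  · push Not at hall
    obtain ⟨i, hi⟩ := hall
    by_cases h0 : (0 : Rn n) ∈ face (simplexO b).1 v
    · rw [facetCoeff, if_neg]
      exact fun h => h.2 ((zero_mem_face_iff _ v).1 h0)
    obtain ⟨f, hf⟩ := exists_functional hb (Pi.single i 1)
    refine facetCoeff_eq_zero_of_subset_ker p (l := f) (by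
      rintro rfl
      simpa using hf i) ?_
    have hconv := face_eq_convexHull (simplexO b) (insert 0 (Finset.univ.image b))
      (by simp [simplexO]) v
    intro x hx
    rw [hconv] at hx
    refine convexHull_min ?_ (LinearMap.ker f).convex hx
    rintro y ⟨hy, hyF⟩
    have hy : y = 0 ∨ ∃ j, b j = y := by simpa using hy
    rcases hy with rfl | ⟨j, rfl⟩
    · exact absurd hyF h0
    · have hji : j ≠ i := by rintro rfl; exact hi hyF
      change f (b j) = 0
      rw [hf]; simp [hji]

/-- Only the normal `w / ‖w‖` contributes. The support value there is `1 / ‖w‖`, and the powers of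
`‖w‖` combine to the ratio in `facetVol_section_div`. -/
theorem projSum_map_stdSimplexO {n : ℕ} {τ : ℝ → ℝ} (hτ : ∀ t, 0 ≤ τ t)
    (hom : ∀ c : ℝ, 0 < c → ∀ t, τ (c * t) = c * τ t) (p : ℝ) {A : Rn n →ₗ[ℝ] Rn n}
    (hA : 0 < LinearMap.det A) (i : Fin n) (x : Rn n) :
    projSum τ p ((stdSimplexO n).map A) (A x) =
      (volume (stdSlab n i)).toReal * (LinearMap.det A * τ (∑ j, x j) ^ p) := by
  have hinj : Function.Injective A := (bijective_of_det_ne_zero hA.ne').1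
  have hb : LinearIndependent ℝ fun j => A (stdVec j) :=
    linearIndependent_stdVec.map' A (LinearMap.ker_eq_bot.2 hinj)
  obtain ⟨w, hw⟩ := exists_inner_eq_one hb
  have hw0 : w ≠ 0 := by rintro rfl; simpa using hw i
  have hw' : 0 < ‖w‖ := norm_pos_iff.2 hw0
  have hin : ∀ x, ⟪A x, w⟫ = ∑ j, x j := by
    intro x
    conv_lhs => rw [← sum_smul_stdVec x, map_sum, sum_inner]
    simp only [map_smul, real_inner_smul_left, hw, mul_one]
  have hPb : (stdSimplexO n).map A = simplexO fun j => A (stdVec j) := by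
    rw [stdSimplexO_eq, PolytopeO.map_simplexO]
  have hmem : ∀ j, A (stdVec j) ∈ ((stdSimplexO n).map A).1 := fun j =>
    ⟨stdVec j, subset_convexHull ℝ _ (Set.mem_insert_of_mem _ ⟨j, rfl⟩), rfl⟩
  have hs : supportFn ((stdSimplexO n).map A).1 (‖w‖⁻¹ • w) = ‖w‖⁻¹ := by
    have h1 : ⟪A (stdVec i), ‖w‖⁻¹ • w⟫ = ‖w‖⁻¹ := by
      rw [real_inner_smul_right, hw, mul_one]
    rw [← h1]
    conv_rhs => rw [← supportFn_eq _ (hmem i) (v := ‖w‖⁻¹ • w) (by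
      rw [h1]
      rintro _ ⟨y, hy, rfl⟩
      rw [real_inner_smul_right, hin]
      exact mul_le_of_le_one_right (by positivity) (mem_stdSimplexO.1 hy).2)]
    rw [h1]
  have hface : face ((stdSimplexO n).map A).1 (‖w‖⁻¹ • w) =
      ((stdSimplexO n).map A).1 ∩ {x | ⟪x, w⟫ = 1} := by
    rw [face, hs]
    ext y
    simp only [Set.mem_inter_iff, Set.mem_ofPred_eq, real_inner_smul_right]
    rw [mul_eq_left₀ (by positivity)]
  have hnorm : ‖‖w‖⁻¹ • w‖ = 1 := by
    rw [norm_smul, norm_inv, norm_norm, inv_mul_cancel₀ hw'.ne']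
  rw [projSum_eq_finsum, finsum_eq_single _ (‖w‖⁻¹ • w) fun v hv => by
    rw [hPb, facetCoeff_simplexO_eq_zero p hb hw hv, zero_mul]]
  have hcalc := facetVol_section_div hA hw i
  rw [facetCoeff, if_pos ⟨hnorm, by rw [hs]; positivity⟩, hs, hface, real_inner_comm,
    real_inner_smul_right, hin, hom _ (by positivity), Real.mul_rpow (by positivity) (hτ _),
    Real.rpow_sub (by positivity), Real.rpow_one]
  have hr : (‖w‖⁻¹ : ℝ) ^ p ≠ 0 := (Real.rpow_pos_of_pos (by positivity) p).ne'
  calc _ = facetVol (((stdSimplexO n).map A).1 ∩ {x | ⟪x, w⟫ = 1}) / ‖w‖ * τ (∑ j, x j) ^ p := by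
        field_simp
    _ = _ := by rw [hcalc]; ring

theorem exists_linearMap_simplexO {n : ℕ} (hn : 2 ≤ n) {b : Fin n → Rn n}
    (hb : LinearIndependent ℝ b) :
    ∃ A : Rn n →ₗ[ℝ] Rn n, 0 < LinearMap.det A ∧ simplexO b = (stdSimplexO n).map A := by
  let B := (EuclideanSpace.basisFun (Fin n) ℝ).toBasis
  have hB : ∀ j, B j = stdVec j := fun j => by simp [B]
  have main : ∀ b' : Fin n → Rn n, Set.range b' = Set.range b →
      simplexO b = (stdSimplexO n).map (B.constr ℝ b') := by
    intro b' hb'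
    rw [stdSimplexO_eq, PolytopeO.map_simplexO]
    refine simplexO_congr ?_
    rw [← hb']
    congr 1
    funext j
    rw [← hB, Module.Basis.constr_basis]
  have hdet : LinearMap.det (B.constr ℝ b) ≠ 0 := by
    intro h0
    refine (LinearMap.bot_lt_ker_of_det_eq_zero h0).ne' (LinearMap.ker_eq_bot'.2 fun x hx => ?_)
    rw [Module.Basis.constr_apply_fintype] at hx
    have := Fintype.linearIndependent_iff.1 hb _ hx
    exact B.ext_elem fun j => by simpa using this j
  rcases lt_or_gt_of_ne hdet with h | h
  -- Exchanging two vertices keeps the simplex and reverses the orientation.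
  · let σ : Equiv.Perm (Fin n) := Equiv.swap ⟨0, by omega⟩ ⟨1, by omega⟩
    refine ⟨B.constr ℝ (b ∘ σ), ?_, main _ (σ.surjective.range_comp b)⟩
    have h1 : ∀ c : Fin n → Rn n, LinearMap.det (B.constr ℝ c) = B.det c := by
      intro c
      rw [← LinearMap.det_toMatrix B, Module.Basis.det_apply]
      congr 1
      ext i j
      rw [LinearMap.toMatrix_apply, Module.Basis.constr_basis, Module.Basis.toMatrix_apply]
    rw [h1] at h ⊢
    rw [AlternatingMap.map_perm, Equiv.Perm.sign_swap (by simp)]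
    simpa using h
  · exact ⟨_, h, main b rfl⟩

theorem profile_pow {n : ℕ} (hn : n ≠ 0) {p : ℝ} (Φ : PolytopeO n → Cp n p) {s : ℝ} (hs : 0 < s)
    (x : Rn n) : profile Φ (s ^ n) x / s ^ p = (Φ ((stdSimplexO n).scale s)).1 x := by
  have hd : dil n (s ^ n) = s := by rw [dil, one_div, Real.pow_rpow_inv_natCast hs.le hn]
  rw [profile, hd, Cp_apply_smul _ hs, mul_div_cancel_left₀ _ (Real.rpow_pos_of_pos hs p).ne']

end LpVal
end

/-! ### Comparison of the valuation with the projection bodies -/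

theorem mainTheorem3 (n : ℕ) (hn : 3 ≤ n) (p : ℝ) (hp : 1 < p)
    (Φ : LpVal.PolytopeO n → LpVal.Cp n p)
    (hval : LpVal.IsValuation Φ)
    (hcontra : LpVal.IsSLContravariant Φ)
    (hdense : ∀ y : LpVal.Rn n, ∃ a b : ℝ, 0 ≤ a ∧ a < b ∧
      ¬ Dense ((fun s : ℝ => (Φ ((LpVal.stdSimplexO n).scale s)).1 y) '' Set.Ioo a b)) :
    ∃ c₁ c₂ : ℝ, ∀ (P : LpVal.PolytopeO n) (u : LpVal.Rn n),
      (Φ P).1 u = c₁ * LpVal.supportFn (LpVal.projBodyPos p P : Set (LpVal.Rn n)) u ^ p +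
        c₂ * LpVal.supportFn (LpVal.projBodyNeg p P : Set (LpVal.Rn n)) u ^ p := by
  open LpVal in
  have hn0 : n ≠ 0 := by omega
  obtain ⟨c₁, c₂, hc⟩ := (isProfile hn hp hval hcontra).classification hn hp (by
    intro σ hσ i hadd t ht
    obtain ⟨a, b, ha, hab, hd⟩ := hdense (σ • stdVec i)
    refine linear_of_not_dense (g := fun t => profile Φ t (σ • stdVec i)) hn0 p hadd ha hab
      ?_ ht
    convert hd using 2
    exact Set.image_congr fun s hs => profile_pow hn0 Φ (ha.trans_lt hs.1) _)
  let i : Fin n := ⟨0, by omega⟩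
  -- The value of both projection sums on `Tⁿ` at vectors where the signed part of the coordinate
  -- sum is `1`; dividing by it normalizes the constants.
  let κ := (MeasureTheory.volume (stdSlab n i)).toReal
  have hκ : 0 < κ := ENNReal.toReal_pos (volume_stdSlab_pos i).ne'
    (slab_volume_lt_top (stdSimplexO n).isCompact.isBounded _ _).ne
  refine ⟨c₁ / κ, c₂ / κ, fun P u => ?_⟩
  rw [supportFn_projBodyPos hp, supportFn_projBodyNeg hp]
  let Ψ : PolytopeO n → ℝ := fun P => (Φ P).1 u -
    (c₁ / κ * projSum (fun t => max t 0) p P u + c₂ / κ * projSum (fun t => max (-t) 0) p P u)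
  have hcut : IsCutAdditive Ψ := by
    intro P l hl
    have h1 := hval.isCutAdditive u P l hl
    have h2 := isCutAdditive_projSum (fun t => max t 0) p u P l hl
    have h3 := isCutAdditive_projSum (fun t => max (-t) 0) p u P l hl
    simp only [Ψ] at h1 h2 h3 ⊢
    linear_combination h1 - c₁ / κ * h2 - c₂ / κ * h3
  have hlow : VanishesBelow n Ψ := by
    intro P hP
    have h1 := vanishesBelow_dim hn hp hval hcontra u P hP
    have h2 := projSum_eq_zero_of_finrank_lt (fun t => max t 0) p u P hP
    have h3 := projSum_eq_zero_of_finrank_lt (fun t => max (-t) 0) p u P hP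
    simp only [Ψ] at h1 h2 h3 ⊢
    rw [h1, h2, h3]; ring
  have hsimp : ∀ b : Fin n → Rn n, LinearIndependent ℝ b → Ψ (simplexO b) = 0 := by
    intro b hb
    obtain ⟨A, hA, hbA⟩ := exists_linearMap_simplexO (by omega) hb
    obtain ⟨x, rfl⟩ := (bijective_of_det_ne_zero hA.ne').2 u
    simp only [Ψ]
    rw [hbA, hcontra.apply_map_stdSimplexO hn0 hA, hc _ hA,
      projSum_map_stdSimplexO (fun _ => le_max_right _ _) (fun c hc t => by
        rw [mul_max_of_nonneg _ _ hc.le, mul_zero]) p hA i,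
      projSum_map_stdSimplexO (fun _ => le_max_right _ _) (fun c hc t => by
        rw [mul_max_of_nonneg _ _ hc.le, mul_zero, mul_neg]) p hA i]
    change _ - (c₁ / κ * (κ * _) + c₂ / κ * (κ * _)) = 0
    field_simp
    ring
  have := hcut.eq_zero (by omega) hlow hsimp P (by
    have := Submodule.finrank_le (Submodule.span ℝ P.1)
    rw [finrank_euclideanSpace_fin] at this
    omega)
  exact sub_eq_zero.1 this
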